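/- Let $\mathcal A=\{a_1,\dots,a_m\}$ be a finite alphabet and let $\mathcal R$ be a (finite or infinite) set of cyclically reduced words over $\mathcal A^{\pm1}$ such that $|R|>1$ for every $R\in\mathcal R$, where $|W|$ denotes the length of a word $W$. Assume that $\mathcal R$ is decidable, i.e. there is an algorithm that decides whether a given word over $\mathcal A^{\pm 1}$ belongs to $\mathcal R$. Let $\langle\langle\mathcal R\rangle\rangle$ be the normal closure of $\mathcal R$ in the free group $F(\mathcal A)$ and let $G=\langle\mathcal A\,\|\,\mathcal R\rangle=F(\mathcal A)/\langle\langle\mathcal R\rangle\rangle$. The word problem for this presentation is solvable if there is an algorithm that decides whether a given word $W$ over $\mathcal A^{\pm1}$ represents an element of $\langle\langle\mathcal R\rangle\rangle$ (written $W\in\langle\langle\mathcal R\rangle\rangle$). A van Kampen diagram over the presentation is a planar, finite, connected and simply connected $2$-complex $\Delta$ whose oriented edges $e$ are labelled by letters $\varphi(e)\in\mathcal A^{\pm1}$ with $\varphi(e^{-1})=\varphi(e)^{-1}$, such that the label of the boundary path of every $2$-cell is, as a cyclic word, a word of $\mathcal R$ or the inverse of such a word. Let $|\Delta(j)|$ be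 the number of $j$-cells of $\Delta$. For a (not necessarily reduced) word $W$ over $\mathcal A^{\pm1}$ with $W\in\langle\langle\mathcal R\rangle\rangle$ let $L_j(W)$ be the minimum of $|\Delta(j)|$ over all van Kampen diagrams $\Delta$ whose boundary path is labelled, literally, by the cyclic word $W$. For $j\in\{0,1\}$ the Dehn $j$-function of the presentation is $$f_j(x)=\max\{L_j(W)\mid W\in\langle\langle\mathcal R\rangle\rangle,\ |W|\le x\}.$$ Then the word problem for $\langle\mathcal A\,\|\,\mathcal R\rangle$ is solvable if and only if the Dehn $0$-function $f_0$ is computable. Moreover, $f_0$ is computable if and only if the Dehn $1$-function $f_1$ is computable. -/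

import Mathlib

/-- Words over the alphabet `𝒜^{±1}`, where `𝒜 = {a₁, …, a_m}`: the letter `(i, true)` is `aᵢ` and
`(i, false)` is `aᵢ⁻¹`. A word need not be reduced. -/
abbrev GWord (m : ℕ) : Type := List (Fin m × Bool)

/-- The word `W` lies in the normal closure of `R` in the free group, that is, `W` represents the
identity of the group `⟨ 𝒜 ‖ R ⟩`. -/
def InNormalClosure {m : ℕ} (R : Set (GWord m)) (W : GWord m) : Prop :=
  FreeGroup.mk W ∈ Subgroup.normalClosure (FreeGroup.mk '' R)

/-- The set of words `R` is decidable. -/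
def DecidableRelators {m : ℕ} (R : Set (GWord m)) : Prop :=
  ComputablePred fun W : GWord m => W ∈ R

/-- The word problem for `⟨ 𝒜 ‖ R ⟩` is solvable. -/
def WordProblemSolvable {m : ℕ} (R : Set (GWord m)) : Prop :=
  ComputablePred fun W : GWord m => InNormalClosure R W

/-- A finite, connected and simply connected 2-complex embedded in the plane, given as a
combinatorial map. Its 1-cells are the elements of `E`, its oriented edges are the pairs `(e, b)`,
and `(e, true)`, `(e, false)` are the two orientations of `e`. The embedding in the plane is
recorded by the clockwise rotation of the oriented edges about their initial vertices. The regions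
of the plane cut out by the 1-skeleton correspond to the closed walks obtained by traversing an
oriented edge `d` and continuing with the edge that follows `d⁻¹` in the rotation (this walk has
the region on its left). One of these regions is the unbounded one; the bounded ones are the
2-cells. -/
structure PlaneComplex where
  /-- the 0-cells -/
  V : Type
  /-- the 1-cells -/
  E : Type
  /-- the 2-cells -/
  F : Type
  [finV : Finite V]
  [finE : Finite E]
  [finF : Finite F]
  [nonemptyV : Nonempty V]
  /-- the initial vertex of an oriented edge -/
  src : E × Bool → V
  /-- the oriented edge that comes next, clockwise about the same initial vertex -/
  rot : Equiv.Perm (E × Bool)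
  /-- the 2-cell on the left of an oriented edge, or `none` if the unbounded region is there -/
  left : E × Bool → Option F
  /-- the oriented edges issuing from a vertex form a single cycle of the rotation -/
  src_eq_iff : ∀ d d' : E × Bool, src d = src d' ↔ rot.SameCycle d d'
  /-- the oriented edges along a region form a single closed walk -/
  left_eq_iff : ∀ d d' : E × Bool, left d = left d' ↔
    Equiv.Perm.SameCycle
      (((Equiv.refl E).prodCongr Equiv.boolNot).trans rot : Equiv.Perm (E × Bool)) d d'
  /-- every 2-cell has an edge on its boundary -/
  exists_left_eq_some : ∀ f : F, ∃ d, left d = some f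
  /-- if there are edges at all, then some edge lies on the boundary of the unbounded region -/
  exists_left_eq_none : Nonempty E → ∃ d, left d = none
  /-- the 1-skeleton is connected -/
  connected : ∀ u v : V,
    Relation.ReflTransGen (fun x y => ∃ e b, src (e, b) = x ∧ src (e, !b) = y) u v
  /-- the Euler characteristic is `1`; with the unbounded region added it is `2`, so the surface
  that carries the map is the sphere -/
  euler : Nat.card V + Nat.card F = Nat.card E + 1

namespace PlaneComplex

/-- The step of the walk along a region, with the region on the left: traverse `d`, then continue
with the oriented edge that follows `d⁻¹` in the clockwise rotation. -/
def next (Δ : PlaneComplex) : Equiv.Perm (Δ.E × Bool) :=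
  ((Equiv.refl Δ.E).prodCongr Equiv.boolNot).trans Δ.rot

/-- The number of `j`-cells. -/
noncomputable def numCells (Δ : PlaneComplex) (j : Fin 3) : ℕ :=
  ![Nat.card Δ.V, Nat.card Δ.E, Nat.card Δ.F] j

end PlaneComplex

/-- A plane 2-complex as above with edges labelled by letters: each edge `e` carries a generator
`a = gen e`, the orientation `(e, true)` is labelled by `a` and `(e, false)` by `a⁻¹`. -/
structure LabelledComplex (m : ℕ) extends PlaneComplex where
  gen : E → Fin m

namespace LabelledComplex

variable {m : ℕ}

/-- The label of an oriented edge. -/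
def label (Δ : LabelledComplex m) (d : Δ.E × Bool) : Fin m × Bool := (Δ.gen d.1, d.2)

/-- The cyclic word read along the boundary walk that starts with `d` and has the region on the
left of `d` on its left. -/
noncomputable def walkLabel (Δ : LabelledComplex m) (d : Δ.E × Bool) : Cycle (Fin m × Bool) :=
  (Function.periodicOrbit Δ.next d).map Δ.label

/-- `Δ` is a van Kampen diagram over `⟨ 𝒜 ‖ R ⟩`: around every 2-cell one reads, as a cyclic word,
a relator or the inverse of a relator. -/
def IsVanKampen (Δ : LabelledComplex m) (R : Set (GWord m)) : Prop :=
  ∀ d : Δ.E × Bool, Δ.left d ≠ none →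
    ∃ r ∈ R, Δ.walkLabel d = (r : Cycle (Fin m × Bool)) ∨
      Δ.walkLabel d = (FreeGroup.invRev r : Cycle (Fin m × Bool))

/-- The boundary of `Δ` is labelled by the cyclic word `W` (literally). The boundary is the walk
along the unbounded region; it is empty if `Δ` is a single vertex. -/
def BoundaryLabel (Δ : LabelledComplex m) (W : GWord m) : Prop :=
  (IsEmpty Δ.E ∧ W = []) ∨
    ∃ d : Δ.E × Bool, Δ.left d = none ∧ Δ.walkLabel d = (W : Cycle (Fin m × Bool))

end LabelledComplex

/-- `L_j(W)`: the minimal number of `j`-cells in a van Kampen diagram over `⟨ 𝒜 ‖ R ⟩` whose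
boundary is labelled by the cyclic word `W`. -/
noncomputable def minCells {m : ℕ} (R : Set (GWord m)) (j : Fin 3) (W : GWord m) : ℕ :=
  sInf {n | ∃ Δ : LabelledComplex m, Δ.IsVanKampen R ∧ Δ.BoundaryLabel W ∧ Δ.numCells j = n}

/-- The Dehn `j`-function `f_j(x)`: the maximum of `L_j(W)` over the words `W` of length at most `x`
in the normal closure of `R`. There are finitely many such words, and the empty word is one. -/
noncomputable def dehnFunction {m : ℕ} (R : Set (GWord m)) (j : Fin 3) (x : ℕ) : ℕ :=
  sSup {n | ∃ W : GWord m, InNormalClosure R W ∧ W.length ≤ x ∧ minCells R j W = n}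

/-! Both equivalences are instances of one statement about diagrams with cost p·(vertices) +
q·(edges), where p + q ≥ 1: the word problem is solvable if and only if the Dehn function of that
cost is computable (`wordProblemSolvable_iff_computable_dehnFunction`). The pair (1, 0) gives `f₀`
and (0, 1) gives `f₁`.

The core is that "W bounds a diagram of cost n" is decidable (`HasDiagram.computablePred`). Relators
have length at least 2, so the boundary length of a diagram is bounded linearly by its cost
(`HasDiagram.length_le`). This applies to every intermediate stage when a diagram is assembled edge
by edge. Hence, even for infinite `R` and for q = 0, only finitely many pairs (word, cost) matter
for a given bound on the cost. Granting this, if the Dehn function f is computable, then W is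
trivial in the group exactly when it bounds a diagram of cost at most f(|W|). Conversely, with a
solvable word problem, f(x) is the least y such that every trivial word of length at most x bounds a
diagram of cost at most y.

The geometry is replaced by the inductive relation `HasDiagram` on boundary words, which joins two
diagrams by a bridge or closes off a face by a new outer edge. `LabelledComplex.hasDiagram` takes a
plane complex apart: deleting an outer edge splits the outer walk, opens a face, or merges two outer
walks, and the Euler characteristic excludes the last case. `HasDiagram.exists_complex` rebuilds a
plane complex from the rules. Together they show that `minCells` is the least cost in the calculus.
Van Kampen's lemma is proved inside the calculus: any boundary edge may be removed first
(`HasDiagram.peel`), hence inverse pairs cancel (`HasDiagram.exists_cancel`), and the elements that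
bound diagrams form a normal subgroup containing the relators. -/

/-! ### Diagrams as a calculus on boundary words -/

/-- The inverse of a letter. -/
def letterInv {m : ℕ} (a : Fin m × Bool) : Fin m × Bool := (a.1, !a.2)

@[simp] theorem letterInv_letterInv {m : ℕ} (a : Fin m × Bool) : letterInv (letterInv a) = a := by
  simp [letterInv]

/-- The cyclic rotations of the words of `R` and of their inverses. -/
def symmetrized {m : ℕ} (R : Set (GWord m)) : Set (GWord m) :=
  {w | ∃ r ∈ R, w ~r r ∨ w ~r FreeGroup.invRev r}

/-- `HasDiagram R p q W c`: the cyclic word `W` bounds a planar diagram over `R`, assembled by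
adding edges one at a time, in which `p` times the number of vertices plus `q` times the number of
edges is `c`. -/
inductive HasDiagram {m : ℕ} (R : Set (GWord m)) (p q : ℕ) : GWord m → ℕ → Prop
  | point : HasDiagram R p q [] p
  | rotate {W W' : GWord m} {c : ℕ} (h : HasDiagram R p q W c) (hr : W ~r W') :
      HasDiagram R p q W' c
  | bridge {u v : GWord m} {c₁ c₂ : ℕ} (a : Fin m × Bool) (hu : HasDiagram R p q u c₁)
      (hv : HasDiagram R p q v c₂) :
      HasDiagram R p q (a :: (u ++ letterInv a :: v)) (c₁ + c₂ + q)
  | face {s w : GWord m} {c : ℕ} (a : Fin m × Bool) (h : HasDiagram R p q (s ++ w) c)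
      (hs : letterInv a :: s ∈ symmetrized R) : HasDiagram R p q (a :: w) (c + q)

/-! ### Rotations and splittings of words -/

theorem List.IsRotated.exists_append {α : Type*} {l l' : List α} (h : l ~r l') :
    ∃ x y, l = x ++ y ∧ l' = y ++ x := by
  obtain ⟨n, hn, rfl⟩ := List.isRotated_iff_mod.1 h
  exact ⟨l.take n, l.drop n, by simp, List.rotate_eq_drop_append_take hn⟩

theorem List.isRotated_of_eq_append {α : Type*} (x y : List α) {l l' : List α} (h : l = x ++ y)
    (h' : l' = y ++ x) : l ~r l' := by
  subst h h'; exact List.isRotated_append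

theorem List.append_eq_append_cons_cases {α : Type*} {u v x y : List α} {a : α}
    (h : u ++ v = x ++ a :: y) :
    (∃ t, u = x ++ a :: t ∧ y = t ++ v) ∨ ∃ t, x = u ++ t ∧ v = t ++ a :: y := by
  rcases List.append_eq_append_iff.1 h with ⟨t, rfl, rfl⟩ | ⟨t, rfl, ht⟩
  · exact Or.inr ⟨t, rfl, rfl⟩
  · cases t with
    | nil => exact Or.inr ⟨[], by simp, by simpa using ht.symm⟩
    | cons b t =>
      simp only [List.cons_append, List.cons.injEq] at ht
      obtain ⟨rfl, rfl⟩ := ht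
      exact Or.inl ⟨t, rfl, rfl⟩

theorem mem_symmetrized_of_isRotated {m : ℕ} {R : Set (GWord m)} {w w' : GWord m}
    (h : w ∈ symmetrized R) (hr : w ~r w') : w' ∈ symmetrized R := by
  obtain ⟨r, hrR, h | h⟩ := h
  exacts [⟨r, hrR, Or.inl (hr.symm.trans h)⟩, ⟨r, hrR, Or.inr (hr.symm.trans h)⟩]

theorem invRev_isRotated {m : ℕ} {w w' : GWord m} (h : w ~r w') :
    FreeGroup.invRev w ~r FreeGroup.invRev w' := by
  simpa only [FreeGroup.invRev] using (h.map _).reverse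

theorem invRev_append' {m : ℕ} (w w' : GWord m) :
    FreeGroup.invRev (w ++ w') = FreeGroup.invRev w' ++ FreeGroup.invRev w := by
  simp [FreeGroup.invRev]

theorem invRev_cons' {m : ℕ} (a : Fin m × Bool) (w : GWord m) :
    FreeGroup.invRev (a :: w) = FreeGroup.invRev w ++ [letterInv a] := by
  simp [FreeGroup.invRev, letterInv]

theorem invRev_mem_symmetrized {m : ℕ} {R : Set (GWord m)} {w : GWord m}
    (h : w ∈ symmetrized R) : FreeGroup.invRev w ∈ symmetrized R := by
  obtain ⟨r, hrR, h | h⟩ := h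
  · exact ⟨r, hrR, Or.inr (invRev_isRotated h)⟩
  · exact ⟨r, hrR, Or.inl (by simpa using invRev_isRotated h)⟩

/-! ### Length bound, soundness, insertion and edge removal in the calculus -/

namespace HasDiagram

variable {m : ℕ} {R : Set (GWord m)} {p q : ℕ}

/-- A new face hides at least one old boundary edge, since its relator has length at least 2; so
only bridges lengthen the boundary. The two letters of a bridge are paid for by `q`, or by the `p`
that both of its parts contribute. The factor 3 is not sharp. -/
theorem length_le (hlen : ∀ r ∈ R, 1 < r.length) (hpq : 1 ≤ p + q) {W : GWord m} {c : ℕ}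
    (h : HasDiagram R p q W c) : W.length + 3 * p ≤ 3 * c := by
  induction h with
  | point => simp
  | rotate h hr ih => rwa [← hr.perm.length_eq]
  | bridge a hu hv ihu ihv => simp only [List.length_cons, List.length_append]; omega
  | @face s w c a h hs ih =>
    have : 1 < (letterInv a :: s).length := by
      obtain ⟨r, hr, h | h⟩ := hs
      · rw [h.perm.length_eq]; exact hlen r hr
      · rw [h.perm.length_eq, FreeGroup.invRev_length]; exact hlen r hr
    simp only [List.length_cons, List.length_append] at *
    omega

theorem mk_mem_of_isRotated {N : Subgroup (FreeGroup (Fin m))} [hN : N.Normal] {W W' : GWord m}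
    (hr : W ~r W') (h : FreeGroup.mk W ∈ N) : FreeGroup.mk W' ∈ N := by
  obtain ⟨x, y, rfl, rfl⟩ := hr.exists_append
  rw [← FreeGroup.mul_mk] at h ⊢
  exact hN.mem_comm h

theorem mk_mem_of_mem_symmetrized {N : Subgroup (FreeGroup (Fin m))} [hN : N.Normal]
    (hR : ∀ r ∈ R, FreeGroup.mk r ∈ N) {w : GWord m} (h : w ∈ symmetrized R) :
    FreeGroup.mk w ∈ N := by
  obtain ⟨r, hr, h | h⟩ := h
  · exact mk_mem_of_isRotated h.symm (hR r hr)
  · refine mk_mem_of_isRotated h.symm ?_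
    rw [← FreeGroup.inv_mk]
    exact N.inv_mem (hR r hr)

theorem mk_cons' (a : Fin m × Bool) (w : GWord m) :
    FreeGroup.mk (a :: w) = FreeGroup.mk [a] * FreeGroup.mk w := by
  simp [FreeGroup.mul_mk]

theorem mk_letterInv (a : Fin m × Bool) :
    FreeGroup.mk [letterInv a] = (FreeGroup.mk [a])⁻¹ := by
  simp [FreeGroup.inv_mk, FreeGroup.invRev, letterInv]

theorem inNormalClosure {W : GWord m} {c : ℕ} (h : HasDiagram R p q W c) :
    InNormalClosure R W := by
  have hR : ∀ r ∈ R, FreeGroup.mk r ∈ Subgroup.normalClosure (FreeGroup.mk '' R) := fun r hr =>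
    Subgroup.subset_normalClosure ⟨r, hr, rfl⟩
  unfold InNormalClosure
  have hN : (Subgroup.normalClosure (FreeGroup.mk '' R)).Normal := inferInstance
  generalize Subgroup.normalClosure (FreeGroup.mk '' R) = N at *
  induction h with
  | point => exact N.one_mem
  | rotate h hr ih => exact mk_mem_of_isRotated hr ih
  | @bridge u v c₁ c₂ a hu hv ihu ihv =>
    have := N.mul_mem (hN.conj_mem _ ihu (FreeGroup.mk [a])) ihv
    rwa [← mk_letterInv, FreeGroup.mul_mk, FreeGroup.mul_mk, FreeGroup.mul_mk,
      List.append_assoc, List.append_assoc] at this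
  | @face s w c a h hs ih =>
    -- The relator gives s·a⁻¹ ∈ N; multiplying its inverse a·s⁻¹ by s·w gives a·w.
    have h1 := hN.mem_comm (mk_cons' _ s ▸ mk_mem_of_mem_symmetrized hR hs)
    rw [mk_letterInv] at h1
    rw [← FreeGroup.mul_mk] at ih
    have := N.mul_mem (N.inv_mem h1) ih
    rw [mk_cons']
    convert this using 1
    group

/-- Reflection of the plane; `symmetrized R` is closed under inversion. -/
theorem mirror {W : GWord m} {c : ℕ} (h : HasDiagram R p q W c) :
    HasDiagram R p q (FreeGroup.invRev W) c := by
  induction h with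
  | point => exact point
  | rotate h hr ih => exact ih.rotate (invRev_isRotated hr)
  | @bridge u v c₁ c₂ a hu hv ihu ihv =>
    refine (bridge a ihu ihv).rotate ?_
    simp only [invRev_append', invRev_cons', letterInv_letterInv]
    exact List.isRotated_of_eq_append
      (a :: (FreeGroup.invRev u ++ [letterInv a])) (FreeGroup.invRev v) (by simp) (by simp)
  | @face s w c a h hs ih =>
    rw [invRev_append'] at ih
    refine (face (letterInv a) (ih.rotate List.isRotated_append) ?_).rotate ?_
    · refine mem_symmetrized_of_isRotated (invRev_mem_symmetrized hs) ?_
      rw [invRev_cons']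
      exact List.isRotated_append
    · rw [invRev_cons']
      exact (List.isRotated_append (l := [letterInv a]))

/-- The diagram for `z` is glued to a vertex of the boundary. The new cost is not tracked, because
only existence is needed for van Kampen's lemma. -/
theorem exists_insert {W z : GWord m} {c d : ℕ} (hz : HasDiagram R p q z d)
    (h : HasDiagram R p q W c) :
    ∀ x y, W = x ++ y → ∃ c', HasDiagram R p q (x ++ z ++ y) c' := by
  induction h with
  | point =>
    intro x y hxy
    obtain ⟨rfl, rfl⟩ := List.append_eq_nil_iff.1 hxy.symm
    exact ⟨d, by simpa using hz⟩
  | rotate h hr ih =>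
    intro x y hxy
    obtain ⟨u, v, rfl, rfl⟩ := hr.exists_append
    rcases List.append_eq_append_iff.1 hxy with ⟨t, rfl, rfl⟩ | ⟨t, rfl, rfl⟩
    · obtain ⟨c', h'⟩ := ih t (y ++ v) (by simp)
      exact ⟨c', h'.rotate (List.isRotated_of_eq_append (t ++ z ++ y) v (by simp) (by simp))⟩
    · obtain ⟨c', h'⟩ := ih (u ++ x) t (by simp)
      exact ⟨c', h'.rotate (List.isRotated_of_eq_append u (x ++ z ++ t) (by simp) (by simp))⟩
  | @bridge u v c₁ c₂ b hu hv ihu ihv =>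
    intro x y hxy
    rcases x with _ | ⟨b', x⟩
    · obtain ⟨c', h'⟩ := ihv v [] (by simp)
      simp only [List.nil_append] at hxy
      subst hxy
      exact ⟨_, (bridge b hu h').rotate (List.isRotated_of_eq_append
        (b :: (u ++ letterInv b :: v)) z (by simp) (by simp))⟩
    · simp only [List.cons_append, List.cons.injEq] at hxy
      obtain ⟨rfl, hxy⟩ := hxy
      rcases List.append_eq_append_cons_cases hxy.symm with ⟨t, rfl, rfl⟩ | ⟨t, rfl, rfl⟩
      · obtain ⟨c', h'⟩ := ihv t y rfl
        exact ⟨_, by simpa using bridge b hu h'⟩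
      · obtain ⟨c', h'⟩ := ihu x t rfl
        exact ⟨_, by simpa using bridge b h' hv⟩
  | @face s w c b h hs ih =>
    intro x y hxy
    rcases x with _ | ⟨b', x⟩
    · obtain ⟨c', h'⟩ := ih (s ++ w) [] (by simp)
      simp only [List.nil_append] at hxy
      subst hxy
      exact ⟨_, (face (w := w ++ z) b (by simpa using h') hs).rotate
        (List.isRotated_of_eq_append (b :: w) z (by simp) (by simp))⟩
    · simp only [List.cons_append, List.cons.injEq] at hxy
      obtain ⟨rfl, rfl⟩ := hxy
      obtain ⟨c', h'⟩ := ih (s ++ x) y (by simp)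
      exact ⟨_, by simpa using face (w := x ++ z ++ y) b (by simpa using h') hs⟩

/-- Any edge on the boundary can be removed first: either it separates the boundary from a face, or
the diagram falls apart. -/
theorem peel {W : GWord m} {c : ℕ} (h : HasDiagram R p q W c) :
    ∀ x a y, W = x ++ a :: y →
      (∃ s c', letterInv a :: s ∈ symmetrized R ∧ HasDiagram R p q (s ++ (y ++ x)) c' ∧
        c = c' + q) ∨
      ∃ u v c₁ c₂, y ++ x = u ++ letterInv a :: v ∧ HasDiagram R p q u c₁ ∧
        HasDiagram R p q v c₂ ∧ c = c₁ + c₂ + q := by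
  induction h with
  | point => intro x a y hW; simp at hW
  | rotate h hr ih =>
    intro x a y hW
    obtain ⟨u, v, rfl, rfl⟩ := hr.exists_append
    rcases List.append_eq_append_cons_cases hW with ⟨t, rfl, rfl⟩ | ⟨t, rfl, rfl⟩
    · simpa using ih (u ++ x) a t (by simp)
    · simpa using ih t a (y ++ v) (by simp)
  | @bridge u v c₁ c₂ b hu hv ihu ihv =>
    intro x a y hW
    rcases x with _ | ⟨b', x⟩
    · simp only [List.nil_append, List.cons.injEq] at hW
      obtain ⟨rfl, rfl⟩ := hW
      exact Or.inr ⟨u, v, c₁, c₂, by simp, hu, hv, rfl⟩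
    simp only [List.cons_append, List.cons.injEq] at hW
    obtain ⟨rfl, hW⟩ := hW
    rcases List.append_eq_append_cons_cases hW with ⟨t, rfl, rfl⟩ | ⟨t, rfl, ht⟩
    · rcases ihu x a t rfl with ⟨s, c', hs, h', rfl⟩ | ⟨u₁, v₁, d₁, d₂, he, h₁, h₂, rfl⟩
      · refine Or.inl ⟨s, c' + c₂ + q, hs, ?_, by omega⟩
        refine (bridge b (u := x ++ s ++ t) (h'.rotate ?_) hv).rotate ?_
        · exact List.isRotated_of_eq_append (s ++ t) x (by simp) (by simp)
        · exact List.isRotated_of_eq_append (b :: x) (s ++ t ++ letterInv b :: v)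
            (by simp) (by simp)
      · right
        rcases List.append_eq_append_cons_cases he with ⟨t', rfl, rfl⟩ | ⟨t', rfl, rfl⟩
        · refine ⟨u₁, t' ++ letterInv b :: v ++ b :: x, d₁, d₂ + c₂ + q, by simp, h₁, ?_,
            by omega⟩
          refine (bridge b (h₂.rotate List.isRotated_append) hv).rotate ?_
          exact List.isRotated_of_eq_append (b :: x) (t' ++ letterInv b :: v) (by simp) (by simp)
        · refine ⟨t ++ letterInv b :: v ++ b :: t', v₁, d₁ + c₂ + q, d₂, by simp, ?_, h₂,
            by omega⟩
          refine (bridge b (h₁.rotate List.isRotated_append) hv).rotate ?_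
          exact List.isRotated_of_eq_append (b :: t') (t ++ letterInv b :: v) (by simp) (by simp)
    · rcases t with _ | ⟨b', t⟩
      -- The chosen letter is the other side of the bridge `b`, so the two parts exchange roles.
      · simp only [List.nil_append, List.cons.injEq] at ht
        obtain ⟨rfl, rfl⟩ := ht
        exact Or.inr ⟨v, u, c₂, c₁, by simp, hv, hu, by omega⟩
      · simp only [List.cons_append, List.cons.injEq] at ht
        obtain ⟨rfl, rfl⟩ := ht
        rcases ihv t a y rfl with ⟨s, c', hs, h', rfl⟩ | ⟨u₁, v₁, d₁, d₂, he, h₁, h₂, rfl⟩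
        · refine Or.inl ⟨s, c₁ + c' + q, hs, ?_, by omega⟩
          refine (bridge b (v := t ++ s ++ y) hu (h'.rotate ?_)).rotate ?_
          · exact List.isRotated_of_eq_append (s ++ y) t (by simp) (by simp)
          · exact List.isRotated_of_eq_append (b :: (u ++ letterInv b :: t)) (s ++ y)
              (by simp) (by simp)
        · right
          rcases List.append_eq_append_cons_cases he with ⟨t', rfl, rfl⟩ | ⟨t', rfl, rfl⟩
          · refine ⟨u₁, t' ++ b :: (u ++ letterInv b :: t), d₁, c₁ + d₂ + q, by simp, h₁, ?_,
              by omega⟩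
            refine (bridge b hu (h₂.rotate List.isRotated_append)).rotate ?_
            exact List.isRotated_of_eq_append (b :: (u ++ letterInv b :: t)) t'
              (by simp) (by simp)
          · refine ⟨y ++ b :: (u ++ letterInv b :: t'), v₁, c₁ + d₁ + q, d₂, by simp, ?_, h₂,
              by omega⟩
            refine (bridge b hu (h₁.rotate List.isRotated_append)).rotate ?_
            exact List.isRotated_of_eq_append (b :: (u ++ letterInv b :: t')) y
              (by simp) (by simp)
  | @face s w c b h hs ih =>
    intro x a y hW
    rcases x with _ | ⟨b', x⟩
    · simp only [List.nil_append, List.cons.injEq] at hW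
      obtain ⟨rfl, rfl⟩ := hW
      exact Or.inl ⟨s, c, hs, by simpa using h, rfl⟩
    simp only [List.cons_append, List.cons.injEq] at hW
    obtain ⟨rfl, rfl⟩ := hW
    rcases ih (s ++ x) a y (by simp) with ⟨t, c', ht, h', rfl⟩ | ⟨u₁, v₁, d₁, d₂, he, h₁, h₂, rfl⟩
    · refine Or.inl ⟨t, c' + q, ht, ?_, by omega⟩
      refine (face (w := x ++ t ++ y) b (h'.rotate ?_) hs).rotate ?_
      · exact List.isRotated_of_eq_append (t ++ y) (s ++ x) (by simp) (by simp)
      · exact List.isRotated_of_eq_append (b :: x) (t ++ y) (by simp) (by simp)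
    · rcases List.append_eq_append_cons_cases he with ⟨t, rfl, rfl⟩ | ⟨t, rfl, he'⟩
      · refine Or.inr ⟨u₁, t ++ b :: x, d₁, d₂ + q, by simp, h₁, ?_, by omega⟩
        refine (face (w := x ++ t) b (h₂.rotate ?_) hs).rotate ?_
        · exact List.isRotated_of_eq_append t (s ++ x) (by simp) (by simp)
        · exact List.isRotated_of_eq_append (b :: x) t (by simp) (by simp)
      · rcases List.append_eq_append_cons_cases he' with ⟨t', rfl, rfl⟩ | ⟨t', rfl, rfl⟩
        -- Before `b` was added, `a` was a bridge with its other side in `s`. The face closed off by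
        -- `b` therefore also borders on `a`: if `a` is removed first, that face is opened and `b`
        -- becomes the bridge.
        · refine Or.inl ⟨t' ++ letterInv b :: t, d₁ + d₂ + q, ?_, ?_, by omega⟩
          · refine mem_symmetrized_of_isRotated hs ?_
            exact List.isRotated_of_eq_append (letterInv b :: t) (letterInv a :: t')
              (by simp) (by simp)
          · refine (bridge (letterInv b) (h₁.rotate List.isRotated_append)
              (h₂.rotate List.isRotated_append)).rotate ?_
            exact List.isRotated_of_eq_append (letterInv b :: (t ++ y ++ b :: x)) t'
              (by simp) (by simp)
        · refine Or.inr ⟨y ++ b :: t', v₁, d₁ + q, d₂, by simp, ?_, h₂, by omega⟩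
          refine (face (w := t' ++ y) b (h₁.rotate ?_) hs).rotate ?_
          · exact List.isRotated_of_eq_append y (s ++ t') (by simp) (by simp)
          · exact List.isRotated_of_eq_append (b :: t') y (by simp) (by simp)

/-! ### Van Kampen's lemma in the calculus -/

/-- Two mutually inverse adjacent letters of the boundary label can be cancelled. -/
theorem exists_cancel (hq : 0 < q) {a : Fin m × Bool} (n : ℕ) :
    ∀ w c, c < n → HasDiagram R p q (a :: letterInv a :: w) c → ∃ c', HasDiagram R p q w c' := by
  induction n with
  | zero => intro w c hc; omega
  | succ n ih =>
    intro w c hc h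
    rcases w with _ | ⟨d, w⟩
    · exact ⟨p, point⟩
    -- Peeling a letter outside the cancelling pair leaves the pair adjacent unless `d` is matched
    -- with one of its letters. The cost drops because `q` is positive.
    have h := h.rotate (W' := d :: (w ++ [a, letterInv a]))
      (List.isRotated_of_eq_append [a, letterInv a] (d :: w) (by simp) (by simp))
    rcases h.peel [] d _ rfl with ⟨s, c', hs, h', rfl⟩ | ⟨u, v, d₁, d₂, he, h₁, h₂, rfl⟩
    · obtain ⟨c'', h''⟩ := ih (s ++ w) c' (by omega) (h'.rotate
        (List.isRotated_of_eq_append (s ++ w) [a, letterInv a] (by simp) (by simp)))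
      exact ⟨_, face d h'' hs⟩
    · simp only [List.append_nil] at he
      rcases List.append_eq_append_cons_cases he with ⟨t, rfl, rfl⟩ | ⟨t, rfl, he'⟩
      · obtain ⟨c'', h''⟩ := ih t d₂ (by omega) (h₂.rotate
          (List.isRotated_of_eq_append t [a, letterInv a] (by simp) (by simp)))
        exact ⟨_, bridge d h₁ h''⟩
      · rcases t with _ | ⟨a', t⟩
        -- The other side of `d` is `a`: then `w` and `[d]` bound separate diagrams, which are glued
        -- together.
        · simp only [List.nil_append, List.cons.injEq] at he'
          obtain ⟨rfl, rfl⟩ := he'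
          simp only [List.append_nil, letterInv_letterInv] at h₁ h₂
          simpa using exists_insert h₁ h₂ [d] [] (by simp)
        · simp only [List.cons_append, List.cons.injEq] at he'
          obtain ⟨rfl, he'⟩ := he'
          rcases t with _ | ⟨a', t⟩
          -- The other side of `d` is `letterInv a`, so `d = a`, and one of the two parts already
          -- has the boundary `d :: w` up to rotation.
          · simp only [List.nil_append, List.cons.injEq] at he'
            have : a = d := by simpa using congrArg letterInv he'.1
            subst this
            exact ⟨_, h₁.rotate List.isRotated_append⟩
          · simp at he'

theorem exists_iff_of_step (hq : 0 < q) {L₁ L₂ : GWord m} (h : FreeGroup.Red.Step L₁ L₂) :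
    (∃ c, HasDiagram R p q L₁ c) ↔ ∃ c, HasDiagram R p q L₂ c := by
  obtain @⟨L₁, L₂, x, b⟩ := h
  constructor
  · rintro ⟨c, h⟩
    obtain ⟨c', h'⟩ := exists_cancel hq (a := (x, b)) (c + 1) (L₂ ++ L₁) c (by omega)
      (h.rotate (List.isRotated_of_eq_append L₁ _ rfl (by simp [letterInv])))
    exact ⟨c', h'.rotate List.isRotated_append⟩
  · rintro ⟨c, h⟩
    have h2 : HasDiagram R p q [(x, b), (x, !b)] (p + p + q) :=
      bridge (u := []) (v := []) (x, b) point point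
    simpa using exists_insert h2 h L₁ L₂ rfl

theorem exists_iff_of_mk_eq (hq : 0 < q) {L₁ L₂ : GWord m}
    (h : FreeGroup.mk L₁ = FreeGroup.mk L₂) :
    (∃ c, HasDiagram R p q L₁ c) ↔ ∃ c, HasDiagram R p q L₂ c := by
  have hred : ∀ {L L' : GWord m}, FreeGroup.Red L L' →
      ((∃ c, HasDiagram R p q L c) ↔ ∃ c, HasDiagram R p q L' c) := by
    intro L L' h
    induction h with
    | refl => rfl
    | tail _ hs ih => exact ih.trans (exists_iff_of_step hq hs)
  obtain ⟨L, h1, h2⟩ := FreeGroup.Red.exact.1 h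
  exact (hred h1).trans (hred h2).symm

/-- For r = b·s the word s·s⁻¹ bounds a diagram since it is trivial in the free group; closing off a
face with label `r` yields the boundary r⁻¹, and the mirror image yields `r`. -/
theorem exists_relator (hq : 0 < q) (hlen : ∀ r ∈ R, 1 < r.length) {r : GWord m} (hr : r ∈ R) :
    ∃ c, HasDiagram R p q r c := by
  rcases r with _ | ⟨b, s⟩
  · exact absurd (hlen _ hr) (by simp)
  obtain ⟨c, h⟩ : ∃ c, HasDiagram R p q (s ++ FreeGroup.invRev s) c := by
    rw [exists_iff_of_mk_eq hq (L₂ := [])]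
    · exact ⟨p, point⟩
    · rw [← FreeGroup.mul_mk, ← FreeGroup.inv_mk, mul_inv_cancel]; rfl
  have h := face (letterInv b) h ⟨_, hr, Or.inl (by simpa using List.IsRotated.refl _)⟩
  refine ⟨_, (h.rotate (W' := FreeGroup.invRev (b :: s)) ?_).mirror.rotate (by simpa using List.IsRotated.refl _)⟩
  rw [invRev_cons']
  exact List.isRotated_append (l := [letterInv b])

/-- Every word in the normal closure bounds a diagram. -/
theorem exists_of_inNormalClosure (hq : 0 < q) (hlen : ∀ r ∈ R, 1 < r.length) {W : GWord m}
    (h : InNormalClosure R W) : ∃ c, HasDiagram R p q W c := by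
  let H : Subgroup (FreeGroup (Fin m)) :=
    { carrier := {g | ∃ c, HasDiagram R p q g.toWord c}
      one_mem' := ⟨p, by simpa using point⟩
      mul_mem' := by
        rintro g h ⟨c, hg⟩ ⟨d, hh⟩
        refine (exists_iff_of_mk_eq hq (L₂ := g.toWord ++ h.toWord) ?_).2 ?_
        · rw [← FreeGroup.mul_mk]; simp [FreeGroup.mk_toWord]
        · simpa using exists_insert hh hg g.toWord [] (by simp)
      inv_mem' := by
        rintro g ⟨c, hg⟩
        exact ⟨c, by simpa [FreeGroup.toWord_inv] using hg.mirror⟩ }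
  have hmem : ∀ L : GWord m, FreeGroup.mk L ∈ H ↔ ∃ c, HasDiagram R p q L c := fun L =>
    exists_iff_of_mk_eq hq FreeGroup.mk_toWord
  have hN : H.Normal := ⟨by
    intro n hn g
    obtain ⟨L, rfl⟩ := Quot.exists_rep n
    obtain ⟨G, rfl⟩ := Quot.exists_rep g
    change FreeGroup.mk L ∈ H at hn
    change FreeGroup.mk G * FreeGroup.mk L * (FreeGroup.mk G)⁻¹ ∈ H
    rw [FreeGroup.inv_mk, FreeGroup.mul_mk, FreeGroup.mul_mk, hmem]
    -- Conjugation is a rotation of boundary words up to free reduction: G·L·G⁻¹ rotates to L·G⁻¹·G.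
    have : ∃ c, HasDiagram R p q (L ++ FreeGroup.invRev G ++ G) c := by
      rw [hmem] at hn
      refine (exists_iff_of_mk_eq hq ?_).1 hn
      rw [← FreeGroup.mul_mk, ← FreeGroup.mul_mk, ← FreeGroup.inv_mk]
      group
    obtain ⟨c, hc⟩ := this
    exact ⟨c, hc.rotate
      (List.isRotated_of_eq_append (L ++ FreeGroup.invRev G) G (by simp) (by simp))⟩⟩
  have hle : Subgroup.normalClosure (FreeGroup.mk '' R) ≤ H := by
    apply Subgroup.normalClosure_le_normal
    rintro _ ⟨r, hr, rfl⟩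
    exact (hmem r).2 (exists_relator hq hlen hr)
  exact (hmem W).1 (hle h)

end HasDiagram

/-! ### Families of face walks and the Euler inequality -/

/-- The list `l` of darts is a walk from `u` to `v`; the dart `d` leads from `src d` to
`src (α d)`. -/
def IsDartWalk {D V : Type} (α : D → D) (src : D → V) : V → List D → V → Prop
  | u, [], v => u = v
  | u, d :: l, v => src d = u ∧ IsDartWalk α src (src (α d)) l v

theorem isDartWalk_append {D V : Type} {α : D → D} {src : D → V} {l l' : List D} {u v : V} :
    IsDartWalk α src u (l ++ l') v ↔ ∃ w, IsDartWalk α src u l w ∧ IsDartWalk α src w l' v := by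
  induction l generalizing u with
  | nil => simp [IsDartWalk]
  | cons d l ih => simp [IsDartWalk, ih, and_assoc]

/-- All darts on a family of based outer faces and a family of inner faces. -/
def faceDarts {D V : Type} (O : Multiset (V × List D)) (I : Multiset (List D)) : Multiset D :=
  O.bind (fun x => (x.2 : Multiset D)) + I.bind (fun l => (l : Multiset D))

/-- The darts that are connected to an outer face. -/
inductive DartReach {D V : Type} (α : D → D) (O : Multiset (V × List D)) (I : Multiset (List D)) :
    D → Prop
  | outer {x : V × List D} {d : D} (hx : x ∈ O) (hd : d ∈ x.2) : DartReach α O I d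
  | flip {d : D} (h : DartReach α O I (α d)) : DartReach α O I d
  | inner {l : List D} {d d' : D} (hl : l ∈ I) (hd : d ∈ l) (hd' : d' ∈ l)
      (h : DartReach α O I d') : DartReach α O I d

/-- The vertex `v` lies on some edge or is an isolated vertex. -/
def IsCovered {D V : Type} (src : D → V) (O : Multiset (V × List D)) (I : Multiset (List D))
    (v : V) : Prop :=
  (∃ d ∈ faceDarts O I, src d = v) ∨ (v, []) ∈ O

/-- A family of closed walks, the outer faces `O` and the inner faces `I`, that together run through
each of finitely many edges once in each direction. -/
structure FaceSystem {m : ℕ} (R : Set (GWord m)) {D V : Type} (α : D → D) (src : D → V)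
    (lab : D → Fin m × Bool) (O : Multiset (V × List D)) (I : Multiset (List D)) : Prop where
  nodup : (faceDarts O I).Nodup
  closed : ∀ d ∈ faceDarts O I, α d ∈ faceDarts O I
  outer : ∀ x ∈ O, IsDartWalk α src x.1 x.2 x.1
  inner : ∀ l ∈ I, ∃ v, IsDartWalk α src v l v
  ne_nil : ∀ l ∈ I, l ≠ []
  relator : ∀ l ∈ I, l.map lab ∈ symmetrized R
  reach : ∀ d ∈ faceDarts O I, DartReach α O I d
  covered : ∀ v, IsCovered src O I v

namespace FaceSystem

variable {m : ℕ} {R : Set (GWord m)} {D V : Type} {α : D → D} {src : D → V}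
  {lab : D → Fin m × Bool} {O O' : Multiset (V × List D)} {I I' : Multiset (List D)}

theorem mem_faceDarts {d : D} :
    d ∈ faceDarts O I ↔ (∃ x ∈ O, d ∈ x.2) ∨ ∃ l ∈ I, d ∈ l := by
  simp [faceDarts]

theorem isCovered_of_walk {u v : V} {l : List D} (hl : ∀ d ∈ l, d ∈ faceDarts O I)
    (hw : IsDartWalk α src u l v) (hv : IsCovered src O I v) : IsCovered src O I u := by
  cases l with
  | nil => exact (show u = v from hw) ▸ hv
  | cons d l => exact Or.inl ⟨d, hl d (by simp), hw.1⟩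

theorem isCovered_of_mem {u : V} {l : List D} (hx : (u, l) ∈ O)
    (hw : IsDartWalk α src u l u) : IsCovered src O I u := by
  cases l with
  | nil => exact Or.inr hx
  | cons d l => exact Or.inl ⟨d, mem_faceDarts.2 (Or.inl ⟨_, hx, by simp⟩), hw.1⟩

/-- Removing an edge. -/
theorem remove (h : FaceSystem R α src lab O I) (hα : ∀ d, α (α d) = d) {d : D}
    (hd : faceDarts O I = d ::ₘ α d ::ₘ faceDarts O' I')
    (hO : ∀ x ∈ O, ∀ z ∈ x.2, z ∈ faceDarts O' I' → ∃ x' ∈ O', z ∈ x'.2)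
    (hI : ∀ l ∈ I, l ∈ I' ∨ ∀ z ∈ l, z ∈ faceDarts O' I' → ∃ x' ∈ O', z ∈ x'.2)
    (hI' : ∀ l ∈ I', l ∈ I) (hwalk : ∀ x ∈ O', IsDartWalk α src x.1 x.2 x.1)
    (hnil : ∀ v, (v, []) ∈ O → (v, []) ∈ O')
    (hcov : IsCovered src O' I' (src d)) (hcov' : IsCovered src O' I' (src (α d))) :
    FaceSystem R α src lab O' I' := by
  have hmem : ∀ z, z ∈ faceDarts O I ↔ z = d ∨ z = α d ∨ z ∈ faceDarts O' I' := by
    intro z; rw [hd]; simp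
  have hnd := h.nodup
  rw [hd, Multiset.nodup_cons, Multiset.nodup_cons, Multiset.mem_cons, not_or] at hnd
  have hcl : ∀ z ∈ faceDarts O' I', α z ∈ faceDarts O' I' := by
    intro z hz
    rcases (hmem _).1 (h.closed z ((hmem z).2 (Or.inr (Or.inr hz)))) with h1 | h1 | h1
    · rw [← h1, hα] at hnd; exact absurd hz hnd.2.1
    · have := congrArg α h1
      rw [hα, hα] at this
      exact absurd (this ▸ hz) hnd.1.2
    · exact h1
  refine ⟨hnd.2.2, hcl, hwalk, fun l hl => h.inner l (hI' l hl), fun l hl => h.ne_nil l (hI' l hl),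
    fun l hl => h.relator l (hI' l hl), ?_, ?_⟩
  · intro z hz
    -- Along the chain that leads from `z` to an outer face, every face is either kept or absorbed
    -- into a new outer face; in the latter case the chain may stop there.
    have hr := h.reach z ((hmem z).2 (Or.inr (Or.inr hz)))
    induction hr with
    | outer hx hdx =>
      obtain ⟨x', hx', hz'⟩ := hO _ hx _ hdx hz
      exact .outer hx' hz'
    | flip _ ih => exact .flip (ih (hcl _ hz))
    | @inner l e e' hl he he' _ ih =>
      rcases hI l hl with hl' | hl'
      · exact .inner hl' he he' (ih (mem_faceDarts.2 (Or.inr ⟨l, hl', he'⟩)))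
      · obtain ⟨x', hx', hz'⟩ := hl' _ he hz
        exact .outer hx' hz'
  · intro v
    rcases h.covered v with ⟨z, hz, rfl⟩ | hv
    · rcases (hmem z).1 hz with rfl | rfl | hz
      · exact hcov
      · exact hcov'
      · exact Or.inl ⟨z, hz, rfl⟩
    · exact Or.inr (hnil v hv)

/-- As long as edges remain, one of them lies on an outer face and can be removed. -/
theorem exists_outer_ne_nil {d : D} (h : DartReach α O I d) : ∃ x ∈ O, x.2 ≠ [] := by
  induction h with
  | outer hx hd => exact ⟨_, hx, List.ne_nil_of_mem hd⟩
  | flip _ ih => exact ih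
  | inner _ _ _ _ ih => exact ih

/-- The words read along the outer faces bound diagrams whose costs add up to `c`. -/
def OuterDiagrams (R : Set (GWord m)) (p q : ℕ) (lab : D → Fin m × Bool)
    (O : Multiset (V × List D)) (c : ℕ) : Prop :=
  ∃ f : Multiset (GWord m × ℕ), f.map Prod.fst = O.map (fun x => x.2.map lab) ∧
    (∀ x ∈ f, HasDiagram R p q x.1 x.2) ∧ (f.map Prod.snd).sum = c

theorem OuterDiagrams.cons_iff {p q c : ℕ} {x : V × List D} :
    OuterDiagrams R p q lab (x ::ₘ O) c ↔ ∃ c₁ c₂, HasDiagram R p q (x.2.map lab) c₁ ∧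
      OuterDiagrams R p q lab O c₂ ∧ c = c₁ + c₂ := by
  constructor
  · rintro ⟨f, hf, hd, rfl⟩
    rw [Multiset.map_cons] at hf
    obtain ⟨y, hy, hyx, hrest⟩ := (Multiset.map_eq_cons _ _ _ _).2 hf
    obtain ⟨f, rfl⟩ := Multiset.exists_cons_of_mem hy
    rw [Multiset.erase_cons_head] at hrest
    exact ⟨y.2, _, hyx ▸ hd y (by simp), ⟨f, hrest, fun z hz => hd z (by simp [hz]), rfl⟩,
      by simp⟩
  · rintro ⟨c₁, c₂, h, ⟨f, hf, hd, rfl⟩, rfl⟩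
    refine ⟨(x.2.map lab, c₁) ::ₘ f, by simp [hf], ?_, by simp⟩
    intro z hz
    rcases Multiset.mem_cons.1 hz with rfl | hz
    exacts [h, hd z hz]

/-- The Euler inequality, and in case of equality the decomposition of the outer faces. -/
theorem euler_le [Finite V] (hα : ∀ d, α (α d) = d) (hlab : ∀ d, lab (α d) = letterInv (lab d))
    (p q n : ℕ) : ∀ (O : Multiset (V × List D)) (I : Multiset (List D)),
      FaceSystem R α src lab O I → (faceDarts O I).card = 2 * n →
      Nat.card V + I.card ≤ n + O.card ∧
        (Nat.card V + I.card = n + O.card →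
          OuterDiagrams R p q lab O (p * Nat.card V + q * n)) := by
  have hne : ∀ d, α d ≠ d := by
    intro d hd
    have := hlab d
    rw [hd] at this
    simpa [letterInv] using congrArg Prod.snd this
  induction n with
  | zero =>
    intro O I h hcard
    have h0 : faceDarts O I = 0 := by simpa using hcard
    have hI : I = 0 := by
      refine Multiset.eq_zero_of_forall_notMem fun l hl => ?_
      obtain ⟨d, hd⟩ := List.exists_mem_of_ne_nil l (h.ne_nil l hl)
      have : d ∈ faceDarts O I := mem_faceDarts.2 (Or.inr ⟨l, hl, hd⟩)
      simp [h0] at this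
    have := Fintype.ofFinite V
    -- Without edges every vertex is isolated and supplies its own empty outer walk. Equality then
    -- means that there are no other outer walks, so the total cost is `p` per vertex.
    have hle : (Finset.univ : Finset V).val.map (fun v => (v, ([] : List D))) ≤ O := by
      rw [Multiset.le_iff_subset]
      · intro x hx
        obtain ⟨v, -, rfl⟩ := Multiset.mem_map.1 hx
        rcases h.covered v with ⟨d, hd, -⟩ | hv
        · simp [h0] at hd
        · exact hv
      · exact Finset.univ.nodup.map fun u v huv => congrArg Prod.fst huv
    have hle' := Multiset.card_le_card hle
    rw [Multiset.card_map] at hle'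
    refine ⟨by simpa [hI, Nat.card_eq_fintype_card] using hle', fun heq => ?_⟩
    have hnil : ∀ x ∈ O, x.2 = [] := by
      intro x hx
      by_contra hx2
      obtain ⟨d, hd⟩ := List.exists_mem_of_ne_nil _ hx2
      have : d ∈ faceDarts O I := mem_faceDarts.2 (Or.inl ⟨x, hx, hd⟩)
      simp [h0] at this
    refine ⟨O.map fun _ => ([], p), ?_, ?_, ?_⟩
    · rw [Multiset.map_map]
      exact Multiset.map_congr rfl fun x hx => by simp [hnil x hx]
    · intro x hx
      obtain ⟨y, -, rfl⟩ := Multiset.mem_map.1 hx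
      exact .point
    · simp only [hI, Multiset.card_zero, add_zero, zero_add] at heq
      rw [Nat.card_eq_fintype_card] at heq
      simp [← heq, mul_comm]
  | succ n ih =>
    intro O I h hcard
    obtain ⟨d₀, hd₀⟩ : ∃ d, d ∈ faceDarts O I :=
      Multiset.card_pos_iff_exists_mem.1 (by omega)
    obtain ⟨⟨b, l⟩, hx, hl⟩ := exists_outer_ne_nil (h.reach d₀ hd₀)
    obtain ⟨d, w, rfl⟩ := List.exists_cons_of_ne_nil hl
    obtain ⟨O, rfl⟩ := Multiset.exists_cons_of_mem hx
    have hdw : src d = b ∧ IsDartWalk α src (src (α d)) w b := h.outer _ hx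
    obtain ⟨rfl, hw⟩ := hdw
    have hαd := h.closed d (mem_faceDarts.2 (Or.inl ⟨_, hx, by simp⟩))
    rw [mem_faceDarts] at hαd
    rcases hαd with ⟨x, hxO, hxd⟩ | ⟨l, hlI, hld⟩
    · rcases Multiset.mem_cons.1 hxO with rfl | hxO
      -- Both sides of the edge lie on the same outer walk: it is a bridge and its removal splits
      -- the walk in two.
      · simp only [List.mem_cons, hne, false_or] at hxd
        obtain ⟨u, v, rfl⟩ := List.append_of_mem hxd
        have hw' := isDartWalk_append.1 hw
        obtain ⟨y, hu, hy, hv⟩ := hw'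
        subst hy
        rw [hα] at hv
        have hdarts : faceDarts ((src d, d :: (u ++ α d :: v)) ::ₘ O) I =
            d ::ₘ α d ::ₘ faceDarts ((src (α d), u) ::ₘ (src d, v) ::ₘ O) I := by
          simp only [faceDarts, Multiset.cons_bind, ← Multiset.coe_add, ← Multiset.cons_coe]
          simp only [← Multiset.singleton_add]
          abel
        have h' : FaceSystem R α src lab ((src (α d), u) ::ₘ (src d, v) ::ₘ O) I := by
          refine h.remove hα hdarts ?_ (fun l hl => Or.inl hl) (fun l hl => hl) ?_ ?_ ?_ ?_
          · intro x hx z hz hz'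
            rcases Multiset.mem_cons.1 hx with rfl | hx
            · have hnd := h.nodup
              rw [hdarts, Multiset.nodup_cons, Multiset.nodup_cons, Multiset.mem_cons,
                not_or] at hnd
              simp only [List.mem_cons, List.mem_append] at hz
              rcases hz with rfl | hz | rfl | hz
              · exact absurd hz' hnd.1.2
              · exact ⟨_, Multiset.mem_cons_self _ _, hz⟩
              · exact absurd hz' hnd.2.1
              · exact ⟨_, Multiset.mem_cons_of_mem (Multiset.mem_cons_self _ _), hz⟩
            · exact ⟨x, by simp [hx], hz⟩
          · intro x hx
            rcases Multiset.mem_cons.1 hx with rfl | hx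
            · exact hu
            rcases Multiset.mem_cons.1 hx with rfl | hx
            · exact hv
            · exact h.outer x (Multiset.mem_cons_of_mem hx)
          · intro v hv
            rcases Multiset.mem_cons.1 hv with hv | hv
            · simp at hv
            · simp [hv]
          · exact isCovered_of_mem (Multiset.mem_cons_of_mem (Multiset.mem_cons_self _ _)) hv
          · exact isCovered_of_mem (Multiset.mem_cons_self _ _) hu
        have hcard' := hcard
        rw [hdarts, Multiset.card_cons, Multiset.card_cons] at hcard'
        obtain ⟨ih1, ih2⟩ := ih _ _ h' (by omega)
        simp only [Multiset.card_cons] at ih1 ih2 ⊢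
        refine ⟨by omega, fun heq => ?_⟩
        have := ih2 (by omega)
        rw [OuterDiagrams.cons_iff] at this
        obtain ⟨c₁, c₂, hc₁, this, hc⟩ := this
        rw [OuterDiagrams.cons_iff] at this
        obtain ⟨c₃, c₄, hc₃, this, rfl⟩ := this
        refine OuterDiagrams.cons_iff.2 ⟨c₁ + c₃ + q, c₄, ?_, this, by rw [mul_add]; omega⟩
        simpa [hlab] using HasDiagram.bridge (lab d) hc₁ hc₃
      -- The edge separates two outer walks. Its removal merges them, so the inequality for the
      -- smaller system makes the present one strict and the case of equality is vacuous.
      · obtain ⟨b', l⟩ := x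
        obtain ⟨O, rfl⟩ := Multiset.exists_cons_of_mem hxO
        obtain ⟨s, t, rfl⟩ := List.append_of_mem hxd
        have hst := isDartWalk_append.1
          (h.outer _ (Multiset.mem_cons_of_mem (Multiset.mem_cons_self _ _)))
        obtain ⟨y, hs, hy, ht⟩ := hst
        simp only at hy hs ht
        subst hy
        rw [hα] at ht
        have hnew : IsDartWalk α src (src d) (t ++ (s ++ w)) (src d) :=
          isDartWalk_append.2 ⟨_, ht, isDartWalk_append.2 ⟨_, hs, hw⟩⟩
        have hdarts : faceDarts ((src d, d :: w) ::ₘ (b', s ++ α d :: t) ::ₘ O) I =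
            d ::ₘ α d ::ₘ faceDarts ((src d, t ++ (s ++ w)) ::ₘ O) I := by
          simp only [faceDarts, Multiset.cons_bind, ← Multiset.coe_add, ← Multiset.cons_coe]
          simp only [← Multiset.singleton_add]
          abel
        have hnd := h.nodup
        rw [hdarts, Multiset.nodup_cons, Multiset.nodup_cons, Multiset.mem_cons,
          not_or] at hnd
        have hbase : IsCovered src ((src d, t ++ (s ++ w)) ::ₘ O) I (src d) :=
          isCovered_of_mem (Multiset.mem_cons_self _ _) hnew
        have h' : FaceSystem R α src lab ((src d, t ++ (s ++ w)) ::ₘ O) I := by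
          refine h.remove hα hdarts ?_ (fun l hl => Or.inl hl) (fun l hl => hl) ?_ ?_ hbase
            (isCovered_of_walk ?_ hw hbase)
          · intro x hx z hz hz'
            rcases Multiset.mem_cons.1 hx with rfl | hx
            · simp only [List.mem_cons] at hz
              rcases hz with rfl | hz
              · exact absurd hz' hnd.1.2
              · exact ⟨_, Multiset.mem_cons_self _ _, by simp [hz]⟩
            rcases Multiset.mem_cons.1 hx with rfl | hx
            · simp only [List.mem_append, List.mem_cons] at hz
              rcases hz with hz | rfl | hz
              · exact ⟨_, Multiset.mem_cons_self _ _, by simp [hz]⟩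
              · exact absurd hz' hnd.2.1
              · exact ⟨_, Multiset.mem_cons_self _ _, by simp [hz]⟩
            · exact ⟨x, by simp [hx], hz⟩
          · intro x hx
            rcases Multiset.mem_cons.1 hx with rfl | hx
            · exact hnew
            · exact h.outer x (Multiset.mem_cons_of_mem (Multiset.mem_cons_of_mem hx))
          · intro v hv
            rcases Multiset.mem_cons.1 hv with hv | hv
            · simp at hv
            rcases Multiset.mem_cons.1 hv with hv | hv
            · simp at hv
            · simp [hv]
          · intro z hz
            exact mem_faceDarts.2 (Or.inl ⟨_, Multiset.mem_cons_self _ _, by simp [hz]⟩)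
        have hcard' := hcard
        rw [hdarts, Multiset.card_cons, Multiset.card_cons] at hcard'
        obtain ⟨ih1, ih2⟩ := ih _ _ h' (by omega)
        simp only [Multiset.card_cons] at ih1 ih2 ⊢
        exact ⟨by omega, fun heq => by omega⟩
    -- The edge separates an outer walk from an inner face, which its removal opens.
    · obtain ⟨I, rfl⟩ := Multiset.exists_cons_of_mem hlI
      obtain ⟨s, t, rfl⟩ := List.append_of_mem hld
      obtain ⟨v₀, hst⟩ := h.inner _ hlI
      have hst := isDartWalk_append.1 hst
      obtain ⟨y, hs, hy, ht⟩ := hst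
      subst hy
      rw [hα] at ht
      have hnew : IsDartWalk α src (src d) (t ++ (s ++ w)) (src d) :=
        isDartWalk_append.2 ⟨_, ht, isDartWalk_append.2 ⟨_, hs, hw⟩⟩
      have hdarts : faceDarts ((src d, d :: w) ::ₘ O) ((s ++ α d :: t) ::ₘ I) =
          d ::ₘ α d ::ₘ faceDarts ((src d, t ++ (s ++ w)) ::ₘ O) I := by
        simp only [faceDarts, Multiset.cons_bind, ← Multiset.coe_add, ← Multiset.cons_coe]
        simp only [← Multiset.singleton_add]
        abel
      have hnd := h.nodup
      rw [hdarts, Multiset.nodup_cons, Multiset.nodup_cons, Multiset.mem_cons,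
        not_or] at hnd
      have hbase : IsCovered src ((src d, t ++ (s ++ w)) ::ₘ O) I (src d) :=
        isCovered_of_mem (Multiset.mem_cons_self _ _) hnew
      have h' : FaceSystem R α src lab ((src d, t ++ (s ++ w)) ::ₘ O) I := by
        refine h.remove hα hdarts ?_ ?_ (fun l hl => Multiset.mem_cons_of_mem hl) ?_ ?_ hbase
          (isCovered_of_walk ?_ hw hbase)
        · intro x hx z hz hz'
          rcases Multiset.mem_cons.1 hx with rfl | hx
          · simp only [List.mem_cons] at hz
            rcases hz with rfl | hz
            · exact absurd hz' hnd.1.2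
            · exact ⟨_, Multiset.mem_cons_self _ _, by simp [hz]⟩
          · exact ⟨x, by simp [hx], hz⟩
        · intro l hl
          rcases Multiset.mem_cons.1 hl with rfl | hl
          · right
            intro z hz hz'
            simp only [List.mem_append, List.mem_cons] at hz
            rcases hz with hz | rfl | hz
            · exact ⟨_, Multiset.mem_cons_self _ _, by simp [hz]⟩
            · exact absurd hz' hnd.2.1
            · exact ⟨_, Multiset.mem_cons_self _ _, by simp [hz]⟩
          · exact Or.inl hl
        · intro x hx
          rcases Multiset.mem_cons.1 hx with rfl | hx
          · exact hnew
          · exact h.outer x (Multiset.mem_cons_of_mem hx)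
        · intro v hv
          rcases Multiset.mem_cons.1 hv with hv | hv
          · simp at hv
          · simp [hv]
        · intro z hz
          exact mem_faceDarts.2 (Or.inl ⟨_, Multiset.mem_cons_self _ _, by simp [hz]⟩)
      have hcard' := hcard
      rw [hdarts, Multiset.card_cons, Multiset.card_cons] at hcard'
      obtain ⟨ih1, ih2⟩ := ih _ _ h' (by omega)
      simp only [Multiset.card_cons] at ih1 ih2 ⊢
      refine ⟨by omega, fun heq => ?_⟩
      have := ih2 (by omega)
      rw [OuterDiagrams.cons_iff] at this
      obtain ⟨c₁, c₂, hc₁, this, hc⟩ := this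
      refine OuterDiagrams.cons_iff.2 ⟨c₁ + q, c₂, ?_, this, by rw [mul_add]; omega⟩
      refine HasDiagram.face (lab d) (s := (t ++ s).map lab) (by simpa using hc₁) ?_
      refine mem_symmetrized_of_isRotated (h.relator _ hlI) ?_
      rw [List.map_append, List.map_append, List.map_cons, hlab]
      exact List.isRotated_of_eq_append (s.map lab) (letterInv (lab d) :: t.map lab)
        (by simp) (by simp)

end FaceSystem

-- Taking a plane complex apart

attribute [instance] PlaneComplex.finV PlaneComplex.finE PlaneComplex.finF PlaneComplex.nonemptyV

namespace PlaneComplex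

/-- The oriented edge `d` with the opposite orientation. -/
def flip (Δ : PlaneComplex) (d : Δ.E × Bool) : Δ.E × Bool := (d.1, !d.2)

variable (Δ : PlaneComplex)

@[simp] theorem flip_flip (d : Δ.E × Bool) : Δ.flip (Δ.flip d) = d := by simp [flip]

theorem next_eq (d : Δ.E × Bool) : Δ.next d = Δ.rot (Δ.flip d) := rfl

theorem src_next (d : Δ.E × Bool) : Δ.src (Δ.next d) = Δ.src (Δ.flip d) :=
  ((Δ.src_eq_iff _ _).2 (Equiv.Perm.sameCycle_apply_right.2 (Equiv.Perm.SameCycle.refl _ _))).symm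

theorem left_next (d : Δ.E × Bool) : Δ.left (Δ.next d) = Δ.left d :=
  ((Δ.left_eq_iff _ _).2 (Equiv.Perm.sameCycle_apply_right.2 (Equiv.Perm.SameCycle.refl _ _))).symm

/-- The walk along the region to the left of `d`, starting with `d`. -/
noncomputable def walk (d : Δ.E × Bool) : List (Δ.E × Bool) :=
  (List.range (Function.minimalPeriod Δ.next d)).map fun n => Δ.next^[n] d

theorem coe_walk (d : Δ.E × Bool) : (Δ.walk d : Cycle _) = Function.periodicOrbit Δ.next d := rfl

theorem walk_nodup (d : Δ.E × Bool) : (Δ.walk d).Nodup := by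
  rw [← Cycle.nodup_coe_iff, coe_walk]; exact Function.nodup_periodicOrbit

theorem mem_walk {d x : Δ.E × Bool} : x ∈ Δ.walk d ↔ Δ.left d = Δ.left x := by
  rw [← Cycle.mem_coe_iff, coe_walk,
    Function.mem_periodicOrbit_iff (Δ.next.injective.mem_periodicPts d), Δ.left_eq_iff]
  constructor
  · rintro ⟨n, rfl⟩
    exact ⟨n, by rw [zpow_natCast, ← Equiv.Perm.iterate_eq_pow]; rfl⟩
  · intro h
    obtain ⟨n, hn⟩ := h.exists_nat_pow_eq
    exact ⟨n, by rw [Equiv.Perm.iterate_eq_pow]; exact hn⟩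

theorem isDartWalk_walk (d : Δ.E × Bool) :
    IsDartWalk Δ.flip Δ.src (Δ.src d) (Δ.walk d) (Δ.src d) := by
  have h : ∀ n, IsDartWalk Δ.flip Δ.src (Δ.src d) ((List.range n).map fun n => Δ.next^[n] d)
      (Δ.src (Δ.next^[n] d)) := by
    intro n
    induction n with
    | zero => rfl
    | succ n ih =>
      rw [List.range_succ, List.map_append, isDartWalk_append]
      refine ⟨_, ih, rfl, ?_⟩
      rw [Function.iterate_succ_apply', src_next]
      rfl
  have := h (Function.minimalPeriod Δ.next d)
  rwa [Function.iterate_minimalPeriod] at this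

/-- Turning about a vertex is a flip followed by a step along a region, since `rot d = next (flip
d)`. A property that is stable under both spreads over all edges at the vertex. -/
theorem sameCycle_rot_induction {P : Δ.E × Bool → Prop} (hflip : ∀ d, P (Δ.flip d) → P d)
    (hleft : ∀ d d', Δ.left d = Δ.left d' → P d → P d') {d d' : Δ.E × Bool}
    (h : Δ.src d = Δ.src d') (hd : P d) : P d' := by
  obtain ⟨n, rfl⟩ := ((Δ.src_eq_iff _ _).1 h).exists_nat_pow_eq
  clear h
  induction n with
  | zero => simpa using hd
  | succ n ih =>
    rw [pow_succ', Equiv.Perm.mul_apply, ← Δ.flip_flip ((Δ.rot ^ n) d), ← next_eq]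
    exact hleft _ _ (Δ.left_next _).symm (hflip _ (by simpa using ih))

end PlaneComplex

open FaceSystem in
/-- A van Kampen diagram can be taken apart edge by edge. -/
theorem LabelledComplex.hasDiagram {m : ℕ} {R : Set (GWord m)} (Δ : LabelledComplex m)
    {W : GWord m} (hΔ : Δ.IsVanKampen R) (hW : Δ.BoundaryLabel W) (p q : ℕ) :
    HasDiagram R p q W (p * Nat.card Δ.V + q * Nat.card Δ.E) := by
  rcases hW with ⟨hE, rfl⟩ | ⟨d₀, hd₀, hW⟩
  -- Without edges, connectedness leaves a single vertex.
  · have hV : Subsingleton Δ.V := ⟨fun u v => by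
      rcases (Δ.connected u v).cases_head with h | ⟨_, ⟨e, _⟩, _⟩
      · exact h
      · exact hE.elim e⟩
    have hV1 : Nat.card Δ.V = 1 := Nat.card_eq_one_iff_unique.2 ⟨hV, Δ.nonemptyV⟩
    rw [hV1, Nat.card_of_isEmpty]
    simpa using HasDiagram.point
  · have := Fintype.ofFinite Δ.F
    have := Fintype.ofFinite Δ.E
    choose rep hrep using Δ.exists_left_eq_some
    set O : Multiset (Δ.V × List (Δ.E × Bool)) := {(Δ.src d₀, Δ.walk d₀)} with hO
    set I : Multiset (List (Δ.E × Bool)) :=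
      (Finset.univ : Finset Δ.F).val.map fun f => Δ.walk (rep f) with hI
    have hmem : ∀ d, d ∈ faceDarts O I := by
      intro d
      rw [mem_faceDarts]
      rcases hd : Δ.left d with _ | f
      · exact Or.inl ⟨_, Multiset.mem_singleton_self _, Δ.mem_walk.2 (by rw [hd₀, hd])⟩
      · exact Or.inr ⟨_, Multiset.mem_map.2 ⟨f, Finset.mem_univ _, rfl⟩,
          Δ.mem_walk.2 (by rw [hrep, hd])⟩
    have hnodup : (faceDarts O I).Nodup := by
      rw [faceDarts, hO, hI, Multiset.singleton_bind, Multiset.bind_map, Multiset.nodup_add,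
        Multiset.nodup_bind]
      refine ⟨Multiset.coe_nodup.2 (Δ.walk_nodup d₀),
        ⟨fun f _ => Multiset.coe_nodup.2 (Δ.walk_nodup _), ?_⟩, ?_⟩
      · refine Finset.univ.nodup.pairwise fun f _ g _ hfg => ?_
        refine Multiset.disjoint_left.2 fun {d} hd hd' => hfg ?_
        have h1 := Δ.mem_walk.1 (Multiset.mem_coe.1 hd)
        have h2 := Δ.mem_walk.1 (Multiset.mem_coe.1 hd')
        rw [hrep] at h1 h2
        exact Option.some.inj (h1.trans h2.symm)
      · refine Multiset.disjoint_left.2 fun {d} hd hd' => ?_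
        obtain ⟨f, -, hd'⟩ := Multiset.mem_bind.1 hd'
        have h1 := Δ.mem_walk.1 (Multiset.mem_coe.1 hd)
        have h2 := Δ.mem_walk.1 (Multiset.mem_coe.1 hd')
        rw [hrep, ← h1, hd₀] at h2
        cases h2
    have hflip : ∀ d, DartReach Δ.flip O I (Δ.flip d) → DartReach Δ.flip O I d :=
      fun d => DartReach.flip
    have hleft : ∀ d d', Δ.left d = Δ.left d' → DartReach Δ.flip O I d →
        DartReach Δ.flip O I d' := by
      intro d d' hdd' h
      rcases hd : Δ.left d with _ | f
      · exact .outer (Multiset.mem_singleton_self _) (Δ.mem_walk.2 (by rw [hd₀, ← hdd', hd]))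
      · exact .inner (Multiset.mem_map.2 ⟨f, Finset.mem_univ _, rfl⟩)
          (Δ.mem_walk.2 (by rw [hrep, ← hdd', hd])) (Δ.mem_walk.2 (by rw [hrep, hd])) h
    -- Connectedness of the 1-skeleton carries reachability from the base point of the outer walk
    -- along a path to `v`.
    have hreach : ∀ v, ∀ d, Δ.src d = v → DartReach Δ.flip O I d := by
      intro v
      induction Δ.connected (Δ.src d₀) v with
      | refl =>
        intro d hd
        exact Δ.sameCycle_rot_induction hflip hleft hd.symm
          (.outer (Multiset.mem_singleton_self _) (Δ.mem_walk.2 rfl))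
      | tail _ hstep ih =>
        intro d hd
        obtain ⟨e, b, hu, hv⟩ := hstep
        exact Δ.sameCycle_rot_induction hflip hleft (hv.trans hd.symm)
          (hflip _ (by simpa [PlaneComplex.flip] using ih _ hu))
    have hsys : FaceSystem R Δ.flip Δ.src Δ.label O I := by
      refine ⟨hnodup, fun d _ => hmem _, ?_, ?_, ?_, ?_, fun d _ => hreach _ d rfl, ?_⟩
      · intro x hx
        rw [Multiset.mem_singleton.1 hx]
        exact Δ.isDartWalk_walk d₀
      · intro l hl
        obtain ⟨f, -, rfl⟩ := Multiset.mem_map.1 hl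
        exact ⟨_, Δ.isDartWalk_walk _⟩
      · intro l hl
        obtain ⟨f, -, rfl⟩ := Multiset.mem_map.1 hl
        exact List.ne_nil_of_mem (Δ.mem_walk.2 (rfl : Δ.left (rep f) = Δ.left (rep f)))
      · intro l hl
        obtain ⟨f, -, rfl⟩ := Multiset.mem_map.1 hl
        obtain ⟨r, hr, h⟩ := hΔ (rep f) (by rw [hrep]; exact Option.some_ne_none f)
        exact ⟨r, hr, h.imp Cycle.coe_eq_coe.1 Cycle.coe_eq_coe.1⟩
      · intro v
        rcases (Δ.connected v (Δ.src d₀)).cases_head with h | ⟨_, ⟨e, b, he, _⟩, _⟩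
        · exact Or.inl ⟨d₀, hmem _, h.symm⟩
        · exact Or.inl ⟨_, hmem _, he⟩
    have hcard : (faceDarts O I).card = 2 * Nat.card Δ.E := by
      have : (⟨faceDarts O I, hnodup⟩ : Finset (Δ.E × Bool)) = Finset.univ :=
        Finset.eq_univ_iff_forall.2 hmem
      have := congrArg Finset.card this
      rw [Finset.card_mk, Finset.card_univ, Fintype.card_prod, Fintype.card_bool] at this
      rw [this, Nat.card_eq_fintype_card, mul_comm]
    have hO1 : O.card = 1 := Multiset.card_singleton _
    have hI1 : I.card = Nat.card Δ.F := by
      rw [hI, Multiset.card_map, Nat.card_eq_fintype_card]; rfl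
    obtain ⟨-, h⟩ := euler_le Δ.flip_flip (lab := Δ.label) (fun d => rfl) p q _ O I hsys hcard
    -- The Euler characteristic of the plane complex is exactly the case of equality with one outer
    -- walk.
    have h := h (by rw [hI1, hO1, Δ.euler])
    rw [hO, ← Multiset.cons_zero, OuterDiagrams.cons_iff] at h
    obtain ⟨c₁, c₂, h₁, ⟨f, hf, -, rfl⟩, hc⟩ := h
    rw [Multiset.map_zero, Multiset.map_eq_zero] at hf
    rw [hc, hf, Multiset.map_zero, Multiset.sum_zero, add_zero]
    exact h₁.rotate (Cycle.coe_eq_coe.1 hW)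

/-! ### Closed walks as cycles of a permutation -/

section Walks

variable {D D' : Type} {σ : D → D}

/-- With `α := σ` and `src := id` a walk is a run of successive iterates of `σ`; the regions of a
complex under construction are described in this form. -/
theorem IsDartWalk.map_range {a b : D} {l : List D} (h : IsDartWalk σ id a l b) :
    l = (List.range l.length).map (fun n => σ^[n] a) ∧ b = σ^[l.length] a := by
  induction l generalizing a with
  | nil => exact ⟨rfl, h.symm⟩
  | cons d l ih =>
    obtain ⟨rfl, h⟩ := h
    obtain ⟨h1, h2⟩ := ih h
    refine ⟨?_, h2⟩
    rw [List.length_cons, List.range_succ_eq_map, List.map_cons, List.map_map]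
    exact congrArg₂ List.cons rfl h1

theorem periodicOrbit_eq_coe {l : List D} {x d : D} (hl : l.Nodup) (h : IsDartWalk σ id x l x)
    (hd : d ∈ l) : Function.periodicOrbit σ d = (l : Cycle D) := by
  obtain ⟨s, t, rfl⟩ := List.append_of_mem hd
  have hr : (s ++ d :: t) ~r (d :: (t ++ s)) :=
    List.isRotated_of_eq_append s (d :: t) rfl (by simp)
  rw [Cycle.coe_eq_coe.2 hr]
  rw [hr.nodup_iff] at hl
  obtain ⟨y, hs, hy, ht⟩ := isDartWalk_append.1 h
  subst hy
  have h : IsDartWalk σ id d (d :: (t ++ s)) d := ⟨rfl, isDartWalk_append.2 ⟨x, ht, hs⟩⟩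
  obtain ⟨h1, h2⟩ := h.map_range
  have hper : Function.minimalPeriod σ d = (d :: (t ++ s)).length := by
    refine le_antisymm (Function.IsPeriodicPt.minimalPeriod_le (by simp) h2.symm) ?_
    by_contra! hlt
    rw [h1] at hl
    have := List.inj_on_of_nodup_map hl (List.mem_range.2 hlt)
      (List.mem_range.2 (by simp : 0 < (d :: (t ++ s)).length))
      (by simp)
    have hpos : 0 < Function.minimalPeriod σ d :=
      Function.IsPeriodicPt.minimalPeriod_pos (n := (d :: (t ++ s)).length) (by simp) h2.symm
    omega
  rw [Function.periodicOrbit_def, hper, ← h1]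

/-- A new edge is inserted just before the first dart of the walk. Only arrivals at that dart are
redirected, hence the condition on the tail alone and the end point `τ b`. -/
theorem IsDartWalk.transfer {σ' : D' → D'} {i τ : D → D'} (h : ∀ z, σ' (i z) = τ (σ z))
    {a b : D} {l : List D} (hl : l ≠ []) (hw : IsDartWalk σ id a l b)
    (ht : ∀ z ∈ l.tail, τ z = i z) : IsDartWalk σ' id (i a) (l.map i) (τ b) := by
  induction l generalizing a with
  | nil => exact absurd rfl hl
  | cons d l ih =>
    obtain ⟨rfl, hw⟩ := hw
    refine ⟨rfl, ?_⟩
    simp only [id, h] at hw ⊢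
    cases l with
    | nil => exact congrArg τ hw
    | cons e l =>
      have he : e = σ d := hw.1
      have := ih (by simp) hw fun z hz => ht z (List.mem_cons_of_mem _ hz)
      rw [← he] at this
      rwa [← he, ht e (by simp)]

theorem IsDartWalk.transfer_closed {σ' : D' → D'} {i τ : D → D'}
    (h : ∀ z, σ' (i z) = τ (σ z)) {l : List D} (hw : ∃ a, IsDartWalk σ id a l a)
    (ht : ∀ z ∈ l, τ z = i z) (y : D') : ∃ a, IsDartWalk σ' id a (l.map i) a := by
  cases l with
  | nil => exact ⟨y, rfl⟩
  | cons d l =>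
    obtain ⟨a, hw⟩ := hw
    have hda : d = a := hw.1
    have := hw.transfer h (by simp) fun z hz => ht z (List.mem_cons_of_mem _ hz)
    rw [← hda, ht d (by simp)] at this
    exact ⟨_, this⟩

theorem IsDartWalk.sameCycle {σ : Equiv.Perm D} {a b : D} {l : List D}
    (h : IsDartWalk σ id a l b) : ∀ d ∈ l, σ.SameCycle a d := by
  induction l generalizing a with
  | nil => simp
  | cons d l ih =>
    obtain ⟨rfl, h⟩ := h
    intro e he
    rcases List.mem_cons.1 he with rfl | he
    · exact Equiv.Perm.SameCycle.refl _ _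
    · exact Equiv.Perm.sameCycle_apply_left.1 (ih h e he)

theorem IsDartWalk.apply_mem {σ : Equiv.Perm D} {a b : D} {l : List D}
    (h : IsDartWalk σ id a l b) : ∀ d ∈ l, σ d ∈ l ∨ σ d = b := by
  induction l generalizing a with
  | nil => simp
  | cons d l ih =>
    obtain ⟨rfl, h⟩ := h
    intro e he
    rcases List.mem_cons.1 he with rfl | he
    · cases l with
      | nil => exact Or.inr h
      | cons e' l => exact Or.inl (by rw [show σ _ = e' from h.1.symm]; simp)
    · exact (ih h e he).imp_left (List.mem_cons_of_mem _)

theorem sameCycle_induction [Finite D] {σ : Equiv.Perm D} {P : D → Prop} {d d' : D}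
    (h : σ.SameCycle d d') (hσ : ∀ x, P x → P (σ x)) (hd : P d) : P d' := by
  obtain ⟨n, rfl⟩ := h.exists_nat_pow_eq
  clear h
  induction n with
  | zero => simpa using hd
  | succ n ih => rw [pow_succ', Equiv.Perm.mul_apply]; exact hσ _ ih

/-- A closed run of iterates lies in one cycle and is invariant under `σ`, so regions listed by such
runs are exactly the cycles. -/
theorem eq_iff_sameCycle_of_walks [Finite D] {F : Type} {σ : Equiv.Perm D} {left : D → F}
    (h : ∀ f, ∃ l : List D, (∃ a, IsDartWalk σ id a l a) ∧ ∀ d, left d = f ↔ d ∈ l) (d d' : D) :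
    left d = left d' ↔ σ.SameCycle d d' := by
  constructor
  · intro hdd'
    obtain ⟨l, ⟨a, hl⟩, hmem⟩ := h (left d')
    exact ((hl.sameCycle d ((hmem d).1 hdd')).symm).trans (hl.sameCycle d' ((hmem d').1 rfl))
  · intro hdd'
    refine sameCycle_induction (P := fun x => left d = left x) hdd' (fun x hx => ?_) rfl
    obtain ⟨l, ⟨a, hl⟩, hmem⟩ := h (left d)
    refine ((hmem _).2 ?_).symm
    have hxl : x ∈ l := (hmem x).1 hx.symm
    rcases hl.apply_mem x hxl with h | h
    · exact h
    · rw [h]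
      cases l with
      | nil => simp at hxl
      | cons e l => rw [show a = e from hl.1.symm]; simp

/-- Multiplying by the swap inserts the fixed point `z` just before `c`: the step t ↦ c becomes t ↦
z ↦ c, so no two elements of a cycle are separated. -/
theorem sameCycle_swap_mul [Finite D] [DecidableEq D] {σ : Equiv.Perm D} {z c d d' : D} (hz : σ z = z)
    (h : σ.SameCycle d d') : (Equiv.swap z c * σ).SameCycle d d' := by
  refine sameCycle_induction (P := (Equiv.swap z c * σ).SameCycle d) h (fun t ht => ht.trans ?_)
    (Equiv.Perm.SameCycle.refl _ _)
  by_cases htz : t = z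
  · rw [htz, hz]
  by_cases htc : σ t = c
  · have h1 : (Equiv.swap z c * σ) t = z := by simp [htc]
    have h2 : (Equiv.swap z c * σ) z = σ t := by simp [hz, htc]
    have h3 := Equiv.Perm.SameCycle.refl (Equiv.swap z c * σ) t
    rw [← Equiv.Perm.sameCycle_apply_right, h1, ← Equiv.Perm.sameCycle_apply_right, h2] at h3
    exact h3
  · have h1 : σ t ≠ z := fun h => htz (σ.injective (h.trans hz.symm))
    have : (Equiv.swap z c * σ) t = σ t := by simp [Equiv.swap_apply_of_ne_of_ne h1 htc]
    rw [← this]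
    exact Equiv.Perm.sameCycle_apply_right.2 (Equiv.Perm.SameCycle.refl _ _)

/-- On `S`, the function `src` is constant exactly along the cycles of `σ`. -/
def IsSourceOn {V : Type} (src : D → V) (σ : Equiv.Perm D) (S : Set D) : Prop :=
  (∀ d, src (σ d) = src d) ∧ ∀ d ∈ S, ∀ d' ∈ S, src d = src d' → σ.SameCycle d d'

/-- The end `z` of a new edge joins the cycle of its vertex by being inserted before some `c` there;
if no dart of `S` starts at that vertex, there is no cycle of `S` to join. -/
theorem IsSourceOn.insert [Finite D] [DecidableEq D] {V : Type} {src : D → V} {σ : Equiv.Perm D} {S : Set D}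
    (h : IsSourceOn src σ S) {z c : D} (hz : σ z = z) (hc : src c = src z)
    (hcS : c ∈ S ∨ ∀ d ∈ S, src d ≠ src z) :
    IsSourceOn src (Equiv.swap z c * σ) (insert z S) := by
  have hzS : ∀ d ∈ S, src d = src z → (Equiv.swap z c * σ).SameCycle z d := by
    intro d hd hdz
    rcases hcS with hcS | hcS
    · have h1 : (Equiv.swap z c * σ) z = c := by simp [hz]
      have h2 := sameCycle_swap_mul (c := c) hz (h.2 c hcS d hd (hc.trans hdz.symm))
      refine Equiv.Perm.sameCycle_apply_left.1 ?_
      rwa [h1]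
    · exact absurd hdz (hcS d hd)
  refine ⟨fun d => ?_, ?_⟩
  · rw [Equiv.Perm.mul_apply, ← h.1 d, Equiv.swap_apply_def]
    split_ifs with h1 h2
    · rw [h1, hc]
    · rw [h2, hc]
    · rfl
  · rintro d (rfl | hd) d' (rfl | hd') hdd'
    · exact Equiv.Perm.SameCycle.refl _ _
    · exact hzS d' hd' hdd'.symm
    · exact (hzS d hd hdd').symm
    · exact sameCycle_swap_mul hz (h.2 d hd d' hd' hdd')

end Walks

/-! ### Adding an edge to a rotation system -/

section AddEdge

variable {E : Type}

/-- An old oriented edge, after an edge has been added. -/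
def oldDart (d : E × Bool) : Option E × Bool := (some d.1, d.2)

theorem oldDart_injective : Function.Injective (oldDart : E × Bool → Option E × Bool) := by
  rintro ⟨e, b⟩ ⟨e', b'⟩ h
  simpa [oldDart] using h

/-- A rotation, extended to a new edge whose two ends are isolated. -/
def extendRot (rot : Equiv.Perm (E × Bool)) : Equiv.Perm (Option E × Bool) where
  toFun
    | (some e, b) => oldDart (rot (e, b))
    | (none, b) => (none, b)
  invFun
    | (some e, b) => oldDart (rot.symm (e, b))
    | (none, b) => (none, b)
  left_inv := by rintro ⟨_ | e, b⟩ <;> simp [oldDart]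
  right_inv := by rintro ⟨_ | e, b⟩ <;> simp [oldDart]

theorem extendRot_oldDart (rot : Equiv.Perm (E × Bool)) (d : E × Bool) :
    extendRot rot (oldDart d) = oldDart (rot d) := rfl

theorem extendRot_none (rot : Equiv.Perm (E × Bool)) (b : Bool) :
    extendRot rot (none, b) = (none, b) := rfl

variable [DecidableEq E]

/-- The rotation with a new edge whose end `(none, b)` is inserted before `cx` and whose end
`(none, !b)` is inserted before `cy`. -/
def addEdgeRot (rot : Equiv.Perm (E × Bool)) (b : Bool) (cx cy : Option E × Bool) :
    Equiv.Perm (Option E × Bool) :=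
  Equiv.swap (none, !b) cy * (Equiv.swap (none, b) cx * extendRot rot)

/-- The effect of `addEdgeRot` on the successor `d` of an old dart. -/
def redirect (b : Bool) (cx cy : Option E × Bool) (d : E × Bool) :
    Option E × Bool :=
  Equiv.swap (none, !b) cy (Equiv.swap (none, b) cx (oldDart d))

variable {rot : Equiv.Perm (E × Bool)} {b : Bool} {cx cy : Option E × Bool}

theorem addEdgeRot_left (h1 : cx ≠ (none, !b)) (h2 : cx ≠ cy) :
    addEdgeRot rot b cx cy (none, b) = cx := by
  simp [addEdgeRot, extendRot_none, Equiv.swap_apply_of_ne_of_ne h1 h2]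

theorem addEdgeRot_right (h1 : cx ≠ (none, !b)) : addEdgeRot rot b cx cy (none, !b) = cy := by
  simp [addEdgeRot, extendRot_none,
    Equiv.swap_apply_of_ne_of_ne (show ((none : Option E), !b) ≠ (none, b) by simp) h1.symm]

theorem redirect_of_ne {d : E × Bool} (hx : oldDart d ≠ cx) (hy : oldDart d ≠ cy) :
    redirect b cx cy d = oldDart d := by
  rw [redirect, Equiv.swap_apply_of_ne_of_ne (by simp [oldDart]) hx,
    Equiv.swap_apply_of_ne_of_ne (by simp [oldDart]) hy]

theorem redirect_left {d : E × Bool} (hx : oldDart d = cx) (hy : cy ≠ (none, b)) :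
    redirect b cx cy d = (none, b) := by
  rw [redirect, hx, Equiv.swap_apply_right, Equiv.swap_apply_of_ne_of_ne (by simp) hy.symm]

/-- This is the case of a new loop, whose second end is inserted before its first, so that arrivals
at `cx` now meet the second end. -/
theorem redirect_left' {d : E × Bool} (hx : oldDart d = cx) (hy : cy = (none, b)) :
    redirect b cx cy d = (none, !b) := by
  rw [redirect, hx, Equiv.swap_apply_right, hy, Equiv.swap_apply_right]

theorem redirect_right {d : E × Bool} (hx : oldDart d ≠ cx) (hy : oldDart d = cy) :
    redirect b cx cy d = (none, !b) := by
  rw [redirect, Equiv.swap_apply_of_ne_of_ne (by simp [oldDart]) hx, hy, Equiv.swap_apply_right]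

/-- The two ends are inserted one after the other, starting from the old darts; the second may be
placed before the first when the new edge is a loop. -/
theorem src_eq_iff_addEdge [Finite E] {V V' : Type} {src : E × Bool → V}
    {src' : Option E × Bool → V'} {j : V → V'} (hj : Function.Injective j)
    (hsrc : ∀ d d', src d = src d' ↔ rot.SameCycle d d')
    (hold : ∀ d, src' (oldDart d) = j (src d)) (hcx : cx ≠ (none, !b))
    (hx : src' cx = src' (none, b)) (hy : src' cy = src' (none, !b))
    (hx' : (∃ t, cx = oldDart t) ∨ ∀ d, j (src d) ≠ src' (none, b))
    (hy' : (cy = (none, b) ∨ ∃ t, cy = oldDart t) ∨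
      src' (none, b) ≠ src' (none, !b) ∧ ∀ d, j (src d) ≠ src' (none, !b))
    (d d' : Option E × Bool) :
    src' d = src' d' ↔ (addEdgeRot rot b cx cy).SameCycle d d' := by
  have hpow : ∀ (n : ℕ) d, (extendRot rot ^ n) (oldDart d) = oldDart ((rot ^ n) d) := by
    intro n
    induction n with
    | zero => intro d; rfl
    | succ n ih =>
      intro d
      rw [pow_succ', Equiv.Perm.mul_apply, ih, extendRot_oldDart, pow_succ', Equiv.Perm.mul_apply]
  have h0 : IsSourceOn src' (extendRot rot) (Set.range oldDart) := by
    refine ⟨?_, ?_⟩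
    · rintro ⟨_ | e, c⟩
      · rfl
      · change src' (extendRot rot (oldDart (e, c))) = src' (oldDart (e, c))
        rw [extendRot_oldDart, hold, hold]
        exact congrArg j ((hsrc _ _).2 (Equiv.Perm.sameCycle_apply_left.2
          (Equiv.Perm.SameCycle.refl _ _)))
    · rintro _ ⟨d, rfl⟩ _ ⟨d', rfl⟩ h
      rw [hold, hold] at h
      obtain ⟨n, hn⟩ := ((hsrc _ _).1 (hj h)).exists_nat_pow_eq
      exact ⟨n, by rw [zpow_natCast, hpow, hn]⟩
  have h1 := h0.insert (z := (none, b)) (c := cx) rfl hx (by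
    rcases hx' with ⟨t, rfl⟩ | hx'
    · exact Or.inl ⟨t, rfl⟩
    · right
      rintro _ ⟨d, rfl⟩
      rw [hold]
      exact hx' d)
  have h2 := h1.insert (z := (none, !b)) (c := cy) (by
      rw [Equiv.Perm.mul_apply, extendRot_none,
        Equiv.swap_apply_of_ne_of_ne (by simp) hcx.symm]) hy (by
    rcases hy' with (rfl | ⟨t, rfl⟩) | ⟨hxy, hy'⟩
    · exact Or.inl (Set.mem_insert _ _)
    · exact Or.inl (Set.mem_insert_of_mem _ ⟨t, rfl⟩)
    · right
      rintro _ (rfl | ⟨d, rfl⟩)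
      · exact hxy
      · rw [hold]
        exact hy' d)
  have hall : ∀ d, d ∈ insert ((none : Option E), !b)
      (insert ((none : Option E), b) (Set.range oldDart)) := by
    rintro ⟨_ | e, c⟩
    · by_cases hcb : c = b
      · simp [hcb]
      · have : c = !b := by cases b <;> cases c <;> simp_all
        simp [this]
    · exact Set.mem_insert_of_mem _ (Set.mem_insert_of_mem _ ⟨(e, c), rfl⟩)
  constructor
  · exact h2.2 d (hall d) d' (hall d')
  · intro h
    exact sameCycle_induction (P := fun x => src' d = src' x) h (fun x hx => hx.trans (h2.1 x).symm)
      rfl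

end AddEdge

/-! ### Building plane complexes: a point, a new face, a bridge -/

namespace LabelledComplex

variable {m : ℕ} {R : Set (GWord m)}

/-- `Δ` is a van Kampen diagram with boundary walk `l` based at `v`, the regions being given by
lists of oriented edges. -/
structure HasWalks (R : Set (GWord m)) (Δ : LabelledComplex m) (v : Δ.V)
    (l : List (Δ.E × Bool)) : Prop where
  nodup : l.Nodup
  walk : l ≠ [] → ∃ a, IsDartWalk Δ.next id a l a
  left_eq_none : ∀ d, Δ.left d = none ↔ d ∈ l
  base : ∀ d t, l = d :: t → Δ.src d = v
  inner : ∀ f, ∃ l' : List (Δ.E × Bool), l'.Nodup ∧ (∃ a, IsDartWalk Δ.next id a l' a) ∧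
    (∀ d, Δ.left d = some f ↔ d ∈ l') ∧ l'.map Δ.label ∈ symmetrized R

theorem HasWalks.isVanKampen {Δ : LabelledComplex m} {v : Δ.V} {l : List (Δ.E × Bool)}
    (h : HasWalks R Δ v l) : Δ.IsVanKampen R := by
  intro d hd
  obtain ⟨f, hf⟩ := Option.ne_none_iff_exists'.1 hd
  obtain ⟨l', hnd, ⟨a, hw⟩, hmem, r, hr, hl⟩ := h.inner f
  refine ⟨r, hr, ?_⟩
  rw [walkLabel, periodicOrbit_eq_coe hnd hw ((hmem d).1 hf), Cycle.map_coe]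
  exact hl.imp Cycle.coe_eq_coe.2 Cycle.coe_eq_coe.2

theorem HasWalks.isEmpty {Δ : LabelledComplex m} {v : Δ.V} (h : HasWalks R Δ v []) :
    IsEmpty Δ.E := by
  by_contra hE
  rw [not_isEmpty_iff] at hE
  obtain ⟨d, hd⟩ := Δ.exists_left_eq_none hE
  simpa using (h.left_eq_none d).1 hd

theorem HasWalks.boundaryLabel {Δ : LabelledComplex m} {v : Δ.V} {l : List (Δ.E × Bool)}
    (h : HasWalks R Δ v l) : Δ.BoundaryLabel (l.map Δ.label) := by
  rcases l with _ | ⟨d, t⟩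
  · exact Or.inl ⟨h.isEmpty, rfl⟩
  · obtain ⟨a, hw⟩ := h.walk (by simp)
    refine Or.inr ⟨d, (h.left_eq_none d).2 (by simp), ?_⟩
    rw [walkLabel, periodicOrbit_eq_coe h.nodup hw (by simp), Cycle.map_coe]

theorem exists_point (R : Set (GWord m)) : ∃ (Δ : LabelledComplex m) (v : Δ.V),
    HasWalks R Δ v [] ∧ Nat.card Δ.V = 1 ∧ Nat.card Δ.E = 0 := by
  refine ⟨{ V := Unit, E := Empty, F := Empty, src := fun _ => (), rot := Equiv.refl _,
            left := fun _ => none, src_eq_iff := fun d => d.1.elim,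
            left_eq_iff := fun d => d.1.elim, exists_left_eq_some := fun f => f.elim,
            exists_left_eq_none := fun ⟨e⟩ => e.elim,
            connected := fun _ _ => Relation.ReflTransGen.refl, euler := by simp,
            gen := fun e => e.elim }, (), ⟨?_, ?_, ?_, ?_, ?_⟩, ?_, ?_⟩
  · exact List.nodup_nil
  · exact fun h => absurd rfl h
  · exact fun d => d.1.elim
  · exact fun d => d.1.elim
  · exact fun f => f.elim
  · exact Nat.card_unique
  · exact Nat.card_of_isEmpty

theorem mem_map_oldDart {E : Type} {l : List (E × Bool)} {e : E} {c : Bool} :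
    (some e, c) ∈ l.map oldDart ↔ (e, c) ∈ l :=
  List.mem_map_of_injective oldDart_injective (a := (e, c))

theorem none_notMem_map_oldDart {E : Type} {l : List (E × Bool)} {c : Bool} :
    (none, c) ∉ l.map oldDart := by
  simp [oldDart]

/-- The new edge is drawn through the unbounded region from the start of `ls` to its end. The region
falls into a new face, bounded by `ls` and one side of the edge, and a new unbounded region, bounded
by `lw` and the other side. Edges and faces each increase by one. -/
theorem exists_addFace (Δ : LabelledComplex m) {v : Δ.V} {ls lw : List (Δ.E × Bool)}
    (h : HasWalks R Δ v (ls ++ lw)) (hls : ls ≠ []) (a : Fin m × Bool)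
    (hs : letterInv a :: ls.map Δ.label ∈ symmetrized R) :
    ∃ (Δ' : LabelledComplex m) (v' : Δ'.V) (l' : List (Δ'.E × Bool)), HasWalks R Δ' v' l' ∧
      l'.map Δ'.label = a :: lw.map Δ.label ∧ Nat.card Δ'.V = Nat.card Δ.V ∧
      Nat.card Δ'.E = Nat.card Δ.E + 1 := by
  classical
  obtain ⟨g, b⟩ := a
  obtain ⟨p, s, rfl⟩ := List.exists_cons_of_ne_nil hls
  have hp : Δ.src p = v := h.base p _ rfl
  -- If `lw` is empty, the new edge is a loop at `v` around the whole diagram and its second end is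
  -- inserted before its first.
  obtain ⟨cy, vy, hcy⟩ : ∃ (cy : Option Δ.E × Bool) (vy : Δ.V),
      (lw = [] ∧ cy = (none, b) ∧ vy = v) ∨
        ∃ q t, lw = q :: t ∧ cy = oldDart q ∧ vy = Δ.src q := by
    rcases lw with _ | ⟨q, t⟩
    · exact ⟨_, _, Or.inl ⟨rfl, rfl, rfl⟩⟩
    · exact ⟨_, _, Or.inr ⟨q, t, rfl, rfl, rfl⟩⟩
  have hnd := List.nodup_append.1 h.nodup
  have hdisj : ∀ d ∈ p :: s, d ∉ lw := fun d hd hd' => hnd.2.2 d hd d hd' rfl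
  have hxy : oldDart p ≠ cy := by
    rcases hcy with ⟨-, rfl, -⟩ | ⟨q, t, rfl, rfl, -⟩
    · simp [oldDart]
    · exact fun h => hdisj p (by simp) (by simp [oldDart_injective h])
  have hpy : oldDart p ≠ (none, !b) := by simp [oldDart]
  let src' : Option Δ.E × Bool → Δ.V := fun
    | (some e, c) => Δ.src (e, c)
    | (none, c) => if c = b then v else vy
  -- The new face is `some none`; it takes over the darts of `ls` from the unbounded region.
  let left' : Option Δ.E × Bool → Option (Option Δ.F) := fun
    | (some e, c) => if (e, c) ∈ p :: s then some none else (Δ.left (e, c)).map some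
    | (none, c) => if c = b then none else some none
  let rot' : Equiv.Perm (Option Δ.E × Bool) := addEdgeRot Δ.rot b (oldDart p) cy
  let next' : Equiv.Perm (Option Δ.E × Bool) :=
    ((Equiv.refl (Option Δ.E)).prodCongr Equiv.boolNot).trans rot'
  have hsrc'x : src' (none, b) = v := if_pos rfl
  have hsrc'y : src' (none, !b) = vy := if_neg (by simp)
  have hnx : next' (none, b) = cy := addEdgeRot_right hpy
  have hny : next' (none, !b) = oldDart p := by
    have := addEdgeRot_left (rot := Δ.rot) hpy hxy
    rw [← this]
    simp [next', rot']
  have hno : ∀ d, next' (oldDart d) = redirect b (oldDart p) cy (Δ.next d) := fun d => rfl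
  have hredir : ∀ d, d ≠ p → (∀ q t, lw = q :: t → d ≠ q) →
      redirect b (oldDart p) cy d = oldDart d := by
    intro d hdp hdq
    refine redirect_of_ne (fun h => hdp (oldDart_injective h)) ?_
    rcases hcy with ⟨-, rfl, -⟩ | ⟨q, t, hq, rfl, -⟩
    · simp [oldDart]
    · exact fun h => hdq q t hq (oldDart_injective h)
  obtain ⟨z, hwalk⟩ := h.walk (by simp)
  have hzp : p = z := hwalk.1
  subst hzp
  obtain ⟨y, hwalk_s, hwalk_w⟩ := isDartWalk_append.1 hwalk
  have hredir_s : ∀ d ∈ s, redirect b (oldDart p) cy d = oldDart d := by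
    intro d hd
    refine hredir d ?_ ?_
    · rintro rfl
      exact (List.nodup_cons.1 hnd.1).1 hd
    · rintro q t rfl rfl
      exact hdisj d (by simp [hd]) (by simp)
  have houter : ∃ a, IsDartWalk next' id a ((none, b) :: lw.map oldDart) a := by
    refine ⟨_, rfl, ?_⟩
    simp only [id, hnx]
    rcases hcy with ⟨rfl, rfl, -⟩ | ⟨q, t, rfl, rfl, -⟩
    · rfl
    · have hqy : q = y := hwalk_w.1
      subst hqy
      have := hwalk_w.transfer hno (by simp) fun d hd => hredir d (fun hdp => hdisj p (by simp)
        (by rw [← hdp]; exact List.mem_of_mem_tail hd)) (by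
          rintro q' t' heq rfl
          obtain ⟨rfl, rfl⟩ := List.cons.inj heq
          exact (List.nodup_cons.1 hnd.2.1).1 hd)
      rwa [redirect_left rfl (by simp [oldDart])] at this
  have hface : ∃ a, IsDartWalk next' id a ((none, !b) :: (p :: s).map oldDart) a := by
    refine ⟨_, rfl, ?_⟩
    simp only [id, hny]
    have := hwalk_s.transfer hno (by simp) hredir_s
    have hy : redirect b (oldDart p) cy y = (none, !b) := by
      rcases hcy with ⟨rfl, rfl, -⟩ | ⟨q, t, rfl, rfl, -⟩
      · exact redirect_left' (congrArg oldDart hwalk_w) rfl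
      · have hqy : q = y := hwalk_w.1
        subst hqy
        exact redirect_right hxy.symm rfl
    rwa [hy] at this
  have hlabel : ∀ l : List (Δ.E × Bool),
      (l.map oldDart).map (fun d => ((d.1.elim g Δ.gen : Fin m), d.2)) = l.map Δ.label := by
    intro l
    rw [List.map_map]
    rfl
  have hold : ∀ f, ∃ l' : List (Option Δ.E × Bool), l'.Nodup ∧
      (∃ a, IsDartWalk next' id a l' a) ∧ (∀ d, left' d = some (some f) ↔ d ∈ l') ∧
      l'.map (fun d => ((d.1.elim g Δ.gen : Fin m), d.2)) ∈ symmetrized R := by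
    intro f
    obtain ⟨l', hl'nd, hl'w, hl'mem, hl'R⟩ := h.inner f
    have hout : ∀ d ∈ l', d ∉ p :: s ++ lw := by
      intro d hd hd'
      have := (hl'mem d).2 hd
      rw [(h.left_eq_none d).2 hd'] at this
      cases this
    refine ⟨l'.map oldDart, hl'nd.map oldDart_injective, ?_, ?_, ?_⟩
    · refine IsDartWalk.transfer_closed hno hl'w ?_ (none, b)
      intro d hd
      refine hredir d ?_ ?_
      · rintro rfl
        exact hout _ hd (by simp)
      · rintro q t rfl rfl
        exact hout _ hd (by simp)
    · rintro ⟨_ | e, c⟩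
      · simp only [left', none_notMem_map_oldDart, iff_false]
        split_ifs <;> simp
      · rw [mem_map_oldDart, ← hl'mem]
        simp only [left']
        split_ifs with hmem
        · simp [(h.left_eq_none (e, c)).2 (by simp only [List.mem_append]; exact Or.inl hmem)]
        · simp
    · rw [hlabel]
      exact hl'R
  have hmem_outer : ∀ d, left' d = none ↔ d ∈ (none, b) :: lw.map oldDart := by
    rintro ⟨_ | e, c⟩
    · by_cases hc : c = b
      · simp [left', hc]
      · simp [left', hc, none_notMem_map_oldDart]
    · rw [List.mem_cons, mem_map_oldDart]
      simp only [left']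
      split_ifs with hmem
      · simpa using hdisj _ hmem
      · rw [Option.map_eq_none_iff, h.left_eq_none, List.mem_append]
        simp [hmem]
  have hmem_face : ∀ d, left' d = some none ↔ d ∈ (none, !b) :: (p :: s).map oldDart := by
    rintro ⟨_ | e, c⟩
    · by_cases hc : c = b
      · simp [left', hc, oldDart]
      · have : c = !b := by cases b <;> cases c <;> simp_all
        simp [left', this]
    · rw [List.mem_cons, mem_map_oldDart]
      simp only [left']
      split_ifs with hmem
      · simp [hmem]
      · simp [hmem]
  have hwalks : ∀ f, ∃ l : List (Option Δ.E × Bool), (∃ a, IsDartWalk next' id a l a) ∧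
      ∀ d, left' d = f ↔ d ∈ l := by
    rintro (_ | _ | f)
    · exact ⟨_, houter, hmem_outer⟩
    · exact ⟨_, hface, hmem_face⟩
    · obtain ⟨l', -, h1, h2, -⟩ := hold f
      exact ⟨l', h1, h2⟩
  refine ⟨{ V := Δ.V, E := Option Δ.E, F := Option Δ.F, src := src', rot := rot', left := left',
            src_eq_iff := ?_, left_eq_iff := eq_iff_sameCycle_of_walks hwalks,
            exists_left_eq_some := ?_, exists_left_eq_none := ?_, connected := ?_, euler := ?_,
            gen := fun e => e.elim g Δ.gen }, v, (none, b) :: lw.map oldDart,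
            ⟨?_, fun _ => houter, hmem_outer, ?_, ?_⟩, ?_, rfl, ?_⟩
  · refine src_eq_iff_addEdge (j := id) Function.injective_id Δ.src_eq_iff (fun d => rfl) hpy ?_ ?_
      (Or.inl ⟨p, rfl⟩) (Or.inl ?_)
    · rw [hsrc'x]; exact hp
    · rw [hsrc'y]
      rcases hcy with ⟨-, rfl, rfl⟩ | ⟨q, t, -, rfl, rfl⟩
      · exact hsrc'x
      · rfl
    · rcases hcy with ⟨-, rfl, -⟩ | ⟨q, t, -, rfl, -⟩
      · exact Or.inl rfl
      · exact Or.inr ⟨q, rfl⟩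
  · rintro (_ | f)
    · exact ⟨(none, !b), (hmem_face (none, !b)).2 (by simp)⟩
    · obtain ⟨d, hd⟩ := Δ.exists_left_eq_some f
      obtain ⟨l', -, -, h2, -⟩ := hold f
      refine ⟨oldDart d, ?_⟩
      change (if d ∈ p :: s then _ else _) = _
      rw [if_neg, hd]; · rfl
      intro hmem
      rw [(h.left_eq_none d).2 (by simp only [List.mem_append]; exact Or.inl hmem)] at hd
      cases hd
  · exact fun _ => ⟨(none, b), (hmem_outer (none, b)).2 (by simp)⟩
  · intro u w
    refine Relation.ReflTransGen.mono (fun x y hxy => ?_) _ _ (Δ.connected u w)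
    obtain ⟨e, c, h1, h2⟩ := hxy
    exact ⟨some e, c, h1, h2⟩
  · have := Δ.euler
    rw [Finite.card_option, Finite.card_option]
    omega
  · exact List.nodup_cons.2 ⟨none_notMem_map_oldDart, hnd.2.1.map oldDart_injective⟩
  · intro d t hd
    obtain ⟨rfl, -⟩ := List.cons.inj hd
    exact hsrc'x
  · rintro (_ | f)
    · refine ⟨_, List.nodup_cons.2 ⟨none_notMem_map_oldDart, hnd.1.map oldDart_injective⟩, hface,
        hmem_face, ?_⟩
      rw [← hlabel] at hs
      exact hs
    · exact hold f
  · rw [← hlabel]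
    rfl
  · exact Finite.card_option

/-- The rotation of a disjoint union. -/
def sumRot {E₁ E₂ : Type} (r₁ : Equiv.Perm (E₁ × Bool)) (r₂ : Equiv.Perm (E₂ × Bool)) :
    Equiv.Perm ((E₁ ⊕ E₂) × Bool) where
  toFun
    | (Sum.inl e, b) => ((r₁ (e, b)).map Sum.inl id)
    | (Sum.inr e, b) => ((r₂ (e, b)).map Sum.inr id)
  invFun
    | (Sum.inl e, b) => ((r₁.symm (e, b)).map Sum.inl id)
    | (Sum.inr e, b) => ((r₂.symm (e, b)).map Sum.inr id)
  left_inv := by rintro ⟨_ | e, b⟩ <;> simp [Prod.map]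
  right_inv := by rintro ⟨_ | e, b⟩ <;> simp [Prod.map]

/-- The initial vertices in a disjoint union. -/
def sumSrc {E₁ E₂ V₁ V₂ : Type} (s₁ : E₁ × Bool → V₁) (s₂ : E₂ × Bool → V₂) :
    (E₁ ⊕ E₂) × Bool → V₁ ⊕ V₂
  | (Sum.inl e, b) => Sum.inl (s₁ (e, b))
  | (Sum.inr e, b) => Sum.inr (s₂ (e, b))

theorem sumSrc_eq_iff {E₁ E₂ V₁ V₂ : Type} [Finite E₁] [Finite E₂] {s₁ : E₁ × Bool → V₁}
    {s₂ : E₂ × Bool → V₂} {r₁ : Equiv.Perm (E₁ × Bool)} {r₂ : Equiv.Perm (E₂ × Bool)}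
    (h₁ : ∀ d d', s₁ d = s₁ d' ↔ r₁.SameCycle d d')
    (h₂ : ∀ d d', s₂ d = s₂ d' ↔ r₂.SameCycle d d') (d d' : (E₁ ⊕ E₂) × Bool) :
    sumSrc s₁ s₂ d = sumSrc s₁ s₂ d' ↔ (sumRot r₁ r₂).SameCycle d d' := by
  have hstep : ∀ d, sumSrc s₁ s₂ (sumRot r₁ r₂ d) = sumSrc s₁ s₂ d := by
    rintro ⟨e | e, b⟩
    · exact congrArg Sum.inl ((h₁ _ _).2 (Equiv.Perm.sameCycle_apply_left.2
        (Equiv.Perm.SameCycle.refl _ (e, b))))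
    · exact congrArg Sum.inr ((h₂ _ _).2 (Equiv.Perm.sameCycle_apply_left.2
        (Equiv.Perm.SameCycle.refl _ (e, b))))
  have hrefl := fun d => Equiv.Perm.SameCycle.refl (sumRot r₁ r₂) d
  constructor
  · rcases d with ⟨e | e, b⟩ <;> rcases d' with ⟨e' | e', b'⟩ <;> intro h
    · exact sameCycle_induction
        (P := fun x => (sumRot r₁ r₂).SameCycle (Sum.inl e, b) (x.map Sum.inl id))
        ((h₁ _ _).1 (Sum.inl_injective h))
        (fun x hx => hx.trans (Equiv.Perm.sameCycle_apply_right.2 (hrefl _))) (hrefl _)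
    · cases h
    · cases h
    · exact sameCycle_induction
        (P := fun x => (sumRot r₁ r₂).SameCycle (Sum.inr e, b) (x.map Sum.inr id))
        ((h₂ _ _).1 (Sum.inr_injective h))
        (fun x hx => hx.trans (Equiv.Perm.sameCycle_apply_right.2 (hrefl _))) (hrefl _)
  · intro h
    exact sameCycle_induction (P := fun x => sumSrc s₁ s₂ d = sumSrc s₁ s₂ x) h
      (fun x hx => hx.trans (hstep x).symm) rfl

-- The new edge runs from `v₂` to `v₁` in the common unbounded region of the disjoint union, and the
-- outer walk traverses it once in each direction.
set_option maxHeartbeats 1000000 in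
theorem exists_addBridge (Δ₁ Δ₂ : LabelledComplex m) {v₁ : Δ₁.V} {v₂ : Δ₂.V}
    {l₁ : List (Δ₁.E × Bool)} {l₂ : List (Δ₂.E × Bool)}
    (h₁ : HasWalks R Δ₁ v₁ l₁) (h₂ : HasWalks R Δ₂ v₂ l₂) (a : Fin m × Bool) :
    ∃ (Δ' : LabelledComplex m) (v' : Δ'.V) (l' : List (Δ'.E × Bool)), HasWalks R Δ' v' l' ∧
      l'.map Δ'.label = a :: (l₁.map Δ₁.label ++ letterInv a :: l₂.map Δ₂.label) ∧
      Nat.card Δ'.V = Nat.card Δ₁.V + Nat.card Δ₂.V ∧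
      Nat.card Δ'.E = Nat.card Δ₁.E + Nat.card Δ₂.E + 1 := by
  classical
  obtain ⟨g, b⟩ := a
  let i₁ : Δ₁.E × Bool → Option (Δ₁.E ⊕ Δ₂.E) × Bool := fun d => oldDart (d.map Sum.inl id)
  let i₂ : Δ₂.E × Bool → Option (Δ₁.E ⊕ Δ₂.E) × Bool := fun d => oldDart (d.map Sum.inr id)
  have hi₁ : Function.Injective i₁ :=
    oldDart_injective.comp (Function.Injective.prodMap Sum.inl_injective Function.injective_id)
  have hi₂ : Function.Injective i₂ :=
    oldDart_injective.comp (Function.Injective.prodMap Sum.inr_injective Function.injective_id)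
  have hi₁₂ : ∀ d d', i₁ d ≠ i₂ d' := by simp [i₁, i₂, oldDart]
  have hi₁n : ∀ d c, i₁ d ≠ (none, c) := by simp [i₁, oldDart]
  have hi₂n : ∀ d c, i₂ d ≠ (none, c) := by simp [i₂, oldDart]
  -- An empty outer walk means an isolated vertex. The new end is alone there, so `cy` is that end
  -- itself and the swap is the identity; likewise for `cx`.
  obtain ⟨cy, hcy⟩ : ∃ cy, (l₁ = [] ∧ cy = (none, !b)) ∨ ∃ q t, l₁ = q :: t ∧ cy = i₁ q := by
    rcases l₁ with _ | ⟨q, t⟩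
    · exact ⟨_, Or.inl ⟨rfl, rfl⟩⟩
    · exact ⟨_, Or.inr ⟨q, t, rfl, rfl⟩⟩
  obtain ⟨cx, hcx⟩ : ∃ cx, (l₂ = [] ∧ cx = (none, b)) ∨ ∃ q t, l₂ = q :: t ∧ cx = i₂ q := by
    rcases l₂ with _ | ⟨q, t⟩
    · exact ⟨_, Or.inl ⟨rfl, rfl⟩⟩
    · exact ⟨_, Or.inr ⟨q, t, rfl, rfl⟩⟩
  have hcx_y : cx ≠ (none, !b) := by
    rcases hcx with ⟨-, rfl⟩ | ⟨q, t, -, rfl⟩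
    · simp
    · exact hi₂n _ _
  have hcy_x : cy ≠ (none, b) := by
    rcases hcy with ⟨-, rfl⟩ | ⟨q, t, -, rfl⟩
    · simp
    · exact hi₁n _ _
  have hcx₁ : ∀ d, i₁ d ≠ cx := by
    intro d
    rcases hcx with ⟨-, rfl⟩ | ⟨q, t, -, rfl⟩
    · exact hi₁n _ _
    · exact hi₁₂ _ _
  have hcy₂ : ∀ d, i₂ d ≠ cy := by
    intro d
    rcases hcy with ⟨-, rfl⟩ | ⟨q, t, -, rfl⟩
    · exact hi₂n _ _
    · exact (hi₁₂ _ _).symm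
  have hcxy : cx ≠ cy := by
    rcases hcx with ⟨-, rfl⟩ | ⟨q, t, -, rfl⟩
    · exact hcy_x.symm
    · exact hcy₂ _
  let src' : Option (Δ₁.E ⊕ Δ₂.E) × Bool → Δ₁.V ⊕ Δ₂.V := fun
    | (some e, c) => sumSrc Δ₁.src Δ₂.src (e, c)
    | (none, c) => if c = b then Sum.inr v₂ else Sum.inl v₁
  let left' : Option (Δ₁.E ⊕ Δ₂.E) × Bool → Option (Δ₁.F ⊕ Δ₂.F) := fun
    | (some (Sum.inl e), c) => (Δ₁.left (e, c)).map Sum.inl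
    | (some (Sum.inr e), c) => (Δ₂.left (e, c)).map Sum.inr
    | (none, _) => none
  let gen' : Option (Δ₁.E ⊕ Δ₂.E) → Fin m := fun e => e.elim g (Sum.elim Δ₁.gen Δ₂.gen)
  let rot' : Equiv.Perm (Option (Δ₁.E ⊕ Δ₂.E) × Bool) :=
    addEdgeRot (sumRot Δ₁.rot Δ₂.rot) b cx cy
  let next' : Equiv.Perm (Option (Δ₁.E ⊕ Δ₂.E) × Bool) :=
    ((Equiv.refl (Option (Δ₁.E ⊕ Δ₂.E))).prodCongr Equiv.boolNot).trans rot'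
  have hsrc'x : src' (none, b) = Sum.inr v₂ := if_pos rfl
  have hsrc'y : src' (none, !b) = Sum.inl v₁ := if_neg (by simp)
  have hnx : next' (none, b) = cy := addEdgeRot_right hcx_y
  have hny : next' (none, !b) = cx := by
    have := addEdgeRot_left (rot := sumRot Δ₁.rot Δ₂.rot) hcx_y hcxy
    rw [← this]
    simp [next', rot']
  have hn₁ : ∀ d, next' (i₁ d) = redirect b cx cy ((Δ₁.next d).map Sum.inl id) := fun d => rfl
  have hn₂ : ∀ d, next' (i₂ d) = redirect b cx cy ((Δ₂.next d).map Sum.inr id) := fun d => rfl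
  have hredir₁ : ∀ d, (∀ q t, l₁ = q :: t → d ≠ q) →
      redirect b cx cy (d.map Sum.inl id) = i₁ d := by
    intro d hdq
    refine redirect_of_ne (hcx₁ d) ?_
    rcases hcy with ⟨-, rfl⟩ | ⟨q, t, hq, rfl⟩
    · exact hi₁n d _
    · exact fun h => hdq q t hq (hi₁ h)
  have hredir₂ : ∀ d, (∀ q t, l₂ = q :: t → d ≠ q) →
      redirect b cx cy (d.map Sum.inr id) = i₂ d := by
    intro d hdq
    refine redirect_of_ne ?_ (hcy₂ d)
    rcases hcx with ⟨-, rfl⟩ | ⟨q, t, hq, rfl⟩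
    · exact hi₂n d _
    · exact fun h => hdq q t hq (hi₂ h)
  have hwalk₁ : IsDartWalk next' id cy (l₁.map i₁) (none, !b) := by
    rcases hcy with ⟨rfl, rfl⟩ | ⟨q, t, rfl, rfl⟩
    · rfl
    · obtain ⟨z, hw⟩ := h₁.walk (by simp)
      have hz : q = z := hw.1
      subst hz
      have := hw.transfer hn₁ (by simp) fun d hd => hredir₁ d (by
        rintro q' t' heq rfl
        obtain ⟨rfl, rfl⟩ := List.cons.inj heq
        exact (List.nodup_cons.1 h₁.nodup).1 hd)
      rwa [redirect_right (hcx₁ q) rfl] at this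
  have hwalk₂ : IsDartWalk next' id cx (l₂.map i₂) (none, b) := by
    rcases hcx with ⟨rfl, rfl⟩ | ⟨q, t, rfl, rfl⟩
    · rfl
    · obtain ⟨z, hw⟩ := h₂.walk (by simp)
      have hz : q = z := hw.1
      subst hz
      have := hw.transfer hn₂ (by simp) fun d hd => hredir₂ d (by
        rintro q' t' heq rfl
        obtain ⟨rfl, rfl⟩ := List.cons.inj heq
        exact (List.nodup_cons.1 h₂.nodup).1 hd)
      rwa [redirect_left rfl hcy_x] at this
  have houter : ∃ a, IsDartWalk next' id a
      ((none, b) :: (l₁.map i₁ ++ (none, !b) :: l₂.map i₂)) a := by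
    refine ⟨_, rfl, isDartWalk_append.2 ⟨_, ?_, rfl, ?_⟩⟩
    · simpa only [id, hnx] using hwalk₁
    · simpa only [id, hny] using hwalk₂
  have hmem₁ : ∀ (l : List (Δ₁.E × Bool)) e c, (some (Sum.inl e), c) ∈ l.map i₁ ↔ (e, c) ∈ l :=
    fun l e c => List.mem_map_of_injective hi₁ (a := (e, c))
  have hmem₂ : ∀ (l : List (Δ₂.E × Bool)) e c, (some (Sum.inr e), c) ∈ l.map i₂ ↔ (e, c) ∈ l :=
    fun l e c => List.mem_map_of_injective hi₂ (a := (e, c))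
  have hmem₁' : ∀ (l : List (Δ₁.E × Bool)) e c, (some (Sum.inr e), c) ∉ l.map i₁ := by
    simp [i₁, oldDart]
  have hmem₂' : ∀ (l : List (Δ₂.E × Bool)) e c, (some (Sum.inl e), c) ∉ l.map i₂ := by
    simp [i₂, oldDart]
  have hmem₁n : ∀ (l : List (Δ₁.E × Bool)) c, (none, c) ∉ l.map i₁ := by
    simp [i₁, oldDart]
  have hmem₂n : ∀ (l : List (Δ₂.E × Bool)) c, (none, c) ∉ l.map i₂ := by
    simp [i₂, oldDart]
  have hmem_outer : ∀ d, left' d = none ↔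
      d ∈ (none, b) :: (l₁.map i₁ ++ (none, !b) :: l₂.map i₂) := by
    rintro ⟨_ | e | e, c⟩
    · by_cases hc : c = b
      · simp [left', hc]
      · have : c = !b := by cases b <;> cases c <;> simp_all
        simp [left', this]
    · rw [List.mem_cons, List.mem_append, hmem₁, List.mem_cons]
      simp [left', h₁.left_eq_none, hmem₂']
    · rw [List.mem_cons, List.mem_append, List.mem_cons, hmem₂]
      simp [left', h₂.left_eq_none, hmem₁']
  have hlabel₁ : ∀ l : List (Δ₁.E × Bool),
      (l.map i₁).map (fun d => (gen' d.1, d.2)) = l.map Δ₁.label := by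
    intro l
    rw [List.map_map]
    rfl
  have hlabel₂ : ∀ l : List (Δ₂.E × Bool),
      (l.map i₂).map (fun d => (gen' d.1, d.2)) = l.map Δ₂.label := by
    intro l
    rw [List.map_map]
    rfl
  have hold : ∀ f, ∃ l' : List (Option (Δ₁.E ⊕ Δ₂.E) × Bool), l'.Nodup ∧
      (∃ a, IsDartWalk next' id a l' a) ∧ (∀ d, left' d = some f ↔ d ∈ l') ∧
      l'.map (fun d => (gen' d.1, d.2)) ∈ symmetrized R := by
    rintro (f | f)
    · obtain ⟨l', hl'nd, hl'w, hl'mem, hl'R⟩ := h₁.inner f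
      refine ⟨l'.map i₁, hl'nd.map hi₁, ?_, ?_, by rwa [hlabel₁]⟩
      · refine IsDartWalk.transfer_closed hn₁ hl'w (fun d hd => hredir₁ d ?_) (none, b)
        rintro q t rfl rfl
        have := (hl'mem d).2 hd
        rw [(h₁.left_eq_none d).2 (by simp)] at this
        cases this
      · rintro ⟨_ | e | e, c⟩
        · simp [left', hmem₁n]
        · rw [hmem₁, ← hl'mem]
          simp [left']
        · simp [left', hmem₁']
    · obtain ⟨l', hl'nd, hl'w, hl'mem, hl'R⟩ := h₂.inner f
      refine ⟨l'.map i₂, hl'nd.map hi₂, ?_, ?_, by rwa [hlabel₂]⟩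
      · refine IsDartWalk.transfer_closed hn₂ hl'w (fun d hd => hredir₂ d ?_) (none, b)
        rintro q t rfl rfl
        have := (hl'mem d).2 hd
        rw [(h₂.left_eq_none d).2 (by simp)] at this
        cases this
      · rintro ⟨_ | e | e, c⟩
        · simp [left', hmem₂n]
        · simp [left', hmem₂']
        · rw [hmem₂, ← hl'mem]
          simp [left']
  have hwalks : ∀ f, ∃ l : List (Option (Δ₁.E ⊕ Δ₂.E) × Bool),
      (∃ a, IsDartWalk next' id a l a) ∧ ∀ d, left' d = f ↔ d ∈ l := by
    rintro (_ | f)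
    · exact ⟨_, houter, hmem_outer⟩
    · obtain ⟨l', -, h1, h2, -⟩ := hold f
      exact ⟨l', h1, h2⟩
  have hconn : ∀ u w : Δ₁.V ⊕ Δ₂.V,
      Relation.ReflTransGen (fun x y => ∃ e c, src' (e, c) = x ∧ src' (e, !c) = y) u w := by
    have hc₁ : ∀ u w : Δ₁.V, Relation.ReflTransGen
        (fun x y => ∃ e c, src' (e, c) = x ∧ src' (e, !c) = y) (Sum.inl u) (Sum.inl w) := by
      intro u w
      refine Relation.ReflTransGen.lift Sum.inl (fun x y hxy => ?_) _ _ (Δ₁.connected u w)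
      obtain ⟨e, c, rfl, rfl⟩ := hxy
      exact ⟨some (Sum.inl e), c, rfl, rfl⟩
    have hc₂ : ∀ u w : Δ₂.V, Relation.ReflTransGen
        (fun x y => ∃ e c, src' (e, c) = x ∧ src' (e, !c) = y) (Sum.inr u) (Sum.inr w) := by
      intro u w
      refine Relation.ReflTransGen.lift Sum.inr (fun x y hxy => ?_) _ _ (Δ₂.connected u w)
      obtain ⟨e, c, rfl, rfl⟩ := hxy
      exact ⟨some (Sum.inr e), c, rfl, rfl⟩
    have hc₂₁ : Relation.ReflTransGen
        (fun x y => ∃ e c, src' (e, c) = x ∧ src' (e, !c) = y) (Sum.inr v₂) (Sum.inl v₁) :=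
      .single ⟨none, b, hsrc'x, hsrc'y⟩
    have hc₁₂ : Relation.ReflTransGen
        (fun x y => ∃ e c, src' (e, c) = x ∧ src' (e, !c) = y) (Sum.inl v₁) (Sum.inr v₂) :=
      .single ⟨none, !b, hsrc'y, (Bool.not_not b).symm ▸ hsrc'x⟩
    rintro (u | u) (w | w)
    · exact hc₁ u w
    · exact ((hc₁ u v₁).trans hc₁₂).trans (hc₂ v₂ w)
    · exact ((hc₂ u v₂).trans hc₂₁).trans (hc₁ v₁ w)
    · exact hc₂ u w
  have hnodup : ((none, b) :: (l₁.map i₁ ++ (none, !b) :: l₂.map i₂)).Nodup := by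
    rw [List.nodup_cons, List.nodup_append, List.nodup_cons, List.mem_append, List.mem_cons]
    refine ⟨?_, h₁.nodup.map hi₁, ⟨hmem₂n _ _, h₂.nodup.map hi₂⟩, ?_⟩
    · rintro (h | h | h)
      · exact hmem₁n _ _ h
      · simp at h
      · exact hmem₂n _ _ h
    · intro x hx y hy
      obtain ⟨d, -, rfl⟩ := List.mem_map.1 hx
      rcases List.mem_cons.1 hy with rfl | hy
      · exact hi₁n _ _
      · obtain ⟨d', -, rfl⟩ := List.mem_map.1 hy
        exact hi₁₂ _ _
  refine ⟨{ V := Δ₁.V ⊕ Δ₂.V, E := Option (Δ₁.E ⊕ Δ₂.E), F := Δ₁.F ⊕ Δ₂.F, src := src',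
            rot := rot', left := left', src_eq_iff := ?_,
            left_eq_iff := eq_iff_sameCycle_of_walks hwalks,
            exists_left_eq_some := ?_, exists_left_eq_none := fun _ => ⟨(none, b), rfl⟩,
            connected := hconn, euler := ?_, gen := gen' },
            Sum.inr v₂, (none, b) :: (l₁.map i₁ ++ (none, !b) :: l₂.map i₂),
            ⟨hnodup, fun _ => houter, hmem_outer, ?_, hold⟩, ?_, Nat.card_sum, ?_⟩
  · refine src_eq_iff_addEdge (j := id) Function.injective_id
      (sumSrc_eq_iff Δ₁.src_eq_iff Δ₂.src_eq_iff) (fun d => rfl) hcx_y ?_ ?_ ?_ ?_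
    · rw [hsrc'x]
      rcases hcx with ⟨-, rfl⟩ | ⟨q, t, rfl, rfl⟩
      · exact hsrc'x
      · exact congrArg Sum.inr (h₂.base q t rfl)
    · rw [hsrc'y]
      rcases hcy with ⟨-, rfl⟩ | ⟨q, t, rfl, rfl⟩
      · exact hsrc'y
      · exact congrArg Sum.inl (h₁.base q t rfl)
    · rcases hcx with ⟨rfl, -⟩ | ⟨q, t, -, rfl⟩
      · right
        rw [hsrc'x]
        rintro ⟨e | e, c⟩
        · simp [sumSrc]
        · exact h₂.isEmpty.elim e
      · exact Or.inl ⟨_, rfl⟩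
    · rcases hcy with ⟨rfl, -⟩ | ⟨q, t, -, rfl⟩
      · right
        rw [hsrc'x, hsrc'y]
        refine ⟨by simp, ?_⟩
        rintro ⟨e | e, c⟩
        · exact h₁.isEmpty.elim e
        · simp [sumSrc]
      · exact Or.inl (Or.inr ⟨_, rfl⟩)
  · rintro (f | f)
    · obtain ⟨d, hd⟩ := Δ₁.exists_left_eq_some f
      exact ⟨i₁ d, congrArg (Option.map Sum.inl) hd⟩
    · obtain ⟨d, hd⟩ := Δ₂.exists_left_eq_some f
      exact ⟨i₂ d, congrArg (Option.map Sum.inr) hd⟩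
  · have := Δ₁.euler
    have := Δ₂.euler
    rw [Finite.card_option, Nat.card_sum, Nat.card_sum, Nat.card_sum]
    omega
  · intro d t hd
    obtain ⟨rfl, -⟩ := List.cons.inj hd
    exact hsrc'x
  · rw [← hlabel₁, ← hlabel₂]
    change (_ :: _) = _
    rw [List.map_append, List.map_cons]
    rfl
  · rw [Finite.card_option, Nat.card_sum]

theorem HasWalks.rotate {Δ : LabelledComplex m} {v : Δ.V} {l l' : List (Δ.E × Bool)}
    (h : HasWalks R Δ v l) (hr : l ~r l') : ∃ v', HasWalks R Δ v' l' := by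
  obtain ⟨x, y, rfl, rfl⟩ := hr.exists_append
  refine ⟨((y ++ x).head?.map Δ.src).getD v, hr.nodup_iff.1 h.nodup, fun hne => ?_,
    fun d => by rw [h.left_eq_none, hr.mem_iff], fun d t ht => by rw [ht]; rfl, h.inner⟩
  obtain ⟨a, hw⟩ := h.walk (fun h => hne (by simp_all))
  obtain ⟨z, h1, h2⟩ := isDartWalk_append.1 hw
  exact ⟨z, isDartWalk_append.2 ⟨a, h2, h1⟩⟩

end LabelledComplex

open LabelledComplex in
/-- The diagrams assembled edge by edge are realized by plane complexes. -/
theorem HasDiagram.exists_complex {m : ℕ} {R : Set (GWord m)} (hlen : ∀ r ∈ R, 1 < r.length)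
    {p q : ℕ} {W : GWord m} {c : ℕ} (h : HasDiagram R p q W c) :
    ∃ Δ : LabelledComplex m, Δ.IsVanKampen R ∧ Δ.BoundaryLabel W ∧
      p * Nat.card Δ.V + q * Nat.card Δ.E = c := by
  suffices ∃ (Δ : LabelledComplex m) (v : Δ.V) (l : List (Δ.E × Bool)), HasWalks R Δ v l ∧
      l.map Δ.label = W ∧ p * Nat.card Δ.V + q * Nat.card Δ.E = c by
    obtain ⟨Δ, v, l, hw, rfl, hc⟩ := this
    exact ⟨Δ, hw.isVanKampen, hw.boundaryLabel, hc⟩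
  induction h with
  | point =>
    obtain ⟨Δ, v, hw, hV, hE⟩ := exists_point R
    exact ⟨Δ, v, [], hw, rfl, by simp [hV, hE]⟩
  | rotate h hr ih =>
    obtain ⟨Δ, v, l, hw, rfl, hc⟩ := ih
    obtain ⟨n, rfl⟩ := hr
    obtain ⟨v', hw'⟩ := hw.rotate (l' := l.rotate n) ⟨n, rfl⟩
    exact ⟨Δ, v', _, hw', List.map_rotate _ _ _, hc⟩
  | bridge a hu hv ihu ihv =>
    obtain ⟨Δ₁, v₁, l₁, hw₁, rfl, rfl⟩ := ihu
    obtain ⟨Δ₂, v₂, l₂, hw₂, rfl, rfl⟩ := ihv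
    obtain ⟨Δ, v, l, hw, hl, hV, hE⟩ := exists_addBridge Δ₁ Δ₂ hw₁ hw₂ a
    exact ⟨Δ, v, l, hw, hl, by rw [hV, hE]; ring⟩
  | @face s w c a h hs ih =>
    obtain ⟨Δ, v, l, hw, hl, rfl⟩ := ih
    obtain ⟨ls, lw, rfl, rfl, rfl⟩ := List.map_eq_append_iff.1 hl
    -- A relator of length greater than 1 leaves at least one old edge on the new face.
    have hne : ls ≠ [] := by
      rintro rfl
      obtain ⟨r, hr, h | h⟩ := hs
      · simpa [← h.perm.length_eq] using hlen r hr
      · have := hlen r hr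
        rw [← FreeGroup.invRev_length, ← h.perm.length_eq] at this
        simp at this
    obtain ⟨Δ', v', l', hw', hl', hV, hE⟩ := exists_addFace Δ hw hne a hs
    exact ⟨Δ', v', l', hw', hl', by rw [hV, hE]; ring⟩

/-! ### Decidable predicates, bounded quantifiers and unbounded search -/

namespace ComputablePred

variable {α β : Type*} [Primcodable α] [Primcodable β]

theorem comp {P : β → Prop} (hP : ComputablePred P) {f : α → β} (hf : Computable f) :
    ComputablePred fun a => P (f a) := by
  obtain ⟨_, h⟩ := hP
  exact ⟨inferInstance, h.comp hf⟩

theorem and {P Q : α → Prop} (hP : ComputablePred P) (hQ : ComputablePred Q) :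
    ComputablePred fun a => P a ∧ Q a := by
  obtain ⟨_, h⟩ := hP
  obtain ⟨_, h'⟩ := hQ
  exact ⟨inferInstance, (Primrec.and.to_comp.comp h h').of_eq fun a => by simp⟩

theorem or {P Q : α → Prop} (hP : ComputablePred P) (hQ : ComputablePred Q) :
    ComputablePred fun a => P a ∨ Q a := by
  obtain ⟨_, h⟩ := hP
  obtain ⟨_, h'⟩ := hQ
  exact ⟨inferInstance, (Primrec.or.to_comp.comp h h').of_eq fun a => by simp⟩

theorem imp {P Q : α → Prop} (hP : ComputablePred P) (hQ : ComputablePred Q) :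
    ComputablePred fun a => P a → Q a :=
  (hP.not.or hQ).of_eq fun _ => imp_iff_not_or.symm

theorem eq {f g : α → β} (hf : Computable f) (hg : Computable g) :
    ComputablePred fun a => f a = g a :=
  (PrimrecPred.computablePred Primrec.eq).comp (hf.pair hg)

theorem exists_bool {P : α → β → Prop} (hP : ComputablePred fun x : α × β => P x.1 x.2) :
    ∃ d : α × β → Bool, Computable d ∧ ∀ a b, d (a, b) = true ↔ P a b := by
  obtain ⟨d, hd, h⟩ := computable_iff.1 hP
  exact ⟨d, hd, fun a b => (iff_of_eq (congrFun h (a, b))).symm⟩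

theorem _root_.Computable.option_casesOn_bool {o : α → Option β} {d : α × β → Bool} (b : Bool)
    (ho : Computable o) (hd : Computable d) :
    Computable fun a => (Option.casesOn (o a) b fun x => d (a, x) : Bool) :=
  Computable.option_casesOn (f := fun _ => b) (g := fun a x => d (a, x)) ho (Computable.const b) hd

/-- Primitive recursion on the index conjoins the values along the list; an index beyond the end
would count as true. -/
theorem forall_mem {P : α → β → Prop} {f : α → List β} (hf : Computable f)
    (hP : ComputablePred fun x : α × β => P x.1 x.2) :
    ComputablePred fun a => ∀ b ∈ f a, P a b := by
  classical
  obtain ⟨d, hd, hdP⟩ := exists_bool hP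
  let step : α → ℕ × Bool → Bool := fun a y =>
    y.2 && Option.casesOn (motive := fun _ => Bool) (f a)[y.1]? true fun b => d (a, b)
  have hstep : Computable₂ step := by
    refine Primrec.and.to_comp.comp (Computable.snd.comp Computable.snd) ?_
    exact Computable.option_casesOn_bool (o := fun x : α × ℕ × Bool => (f x.1)[x.2.1]?)
      (d := fun x : (α × ℕ × Bool) × β => d (x.1.1, x.2)) true
      (Computable.list_getElem?.comp (hf.comp Computable.fst) (Computable.fst.comp Computable.snd))
      (hd.comp ((Computable.fst.comp Computable.fst).pair Computable.snd))
  have h := Computable.nat_rec (Computable.list_length.comp hf) (Computable.const true) hstep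
  refine Computable.computablePred (h.of_eq fun a => ?_)
  have key : ∀ n, (Nat.rec true (fun y IH => step a (y, IH)) n : Bool) = true ↔
      ∀ i < n, ∀ b, (f a)[i]? = some b → P a b := by
    intro n
    induction n with
    | zero => simp
    | succ n ih =>
      simp only [step, Bool.and_eq_true, ih] at ih ⊢
      rw [Nat.forall_lt_succ_right]
      refine and_congr Iff.rfl ?_
      cases (f a)[n]? <;> simp [hdP]
  rw [Bool.eq_iff_iff, key, decide_eq_true_iff]
  constructor
  · intro h b hb
    obtain ⟨i, hi⟩ := List.mem_iff_getElem?.1 hb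
    exact h i (List.getElem?_eq_some_iff.1 hi).1 b hi
  · intro h i _ b hb
    exact h b (List.mem_of_getElem? hb)

theorem exists_mem {P : α → β → Prop} {f : α → List β} (hf : Computable f)
    (hP : ComputablePred fun x : α × β => P x.1 x.2) :
    ComputablePred fun a => ∃ b ∈ f a, P a b :=
  (forall_mem (P := fun a b => ¬P a b) hf hP.not).not.of_eq fun a => by simp

theorem mem {f : α → List β} {g : α → β} (hf : Computable f) (hg : Computable g) :
    ComputablePred fun a => g a ∈ f a :=
  (exists_mem (P := fun a b => g a = b) hf
    (eq (hg.comp Computable.fst) Computable.snd)).of_eq fun a => by simp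

/-- Unbounded search through the codes of elements of `β`; numbers that code nothing are rejected.
-/
theorem exists_re {P : α → β → Prop} (hP : ComputablePred fun x : α × β => P x.1 x.2) :
    REPred fun a => ∃ b, P a b := by
  obtain ⟨d, hd, hdP⟩ := exists_bool hP
  let g : α → ℕ → Bool := fun a n =>
    Option.casesOn (motive := fun _ => Bool) (Encodable.decode (α := β) n) false fun b => d (a, b)
  have hg : Computable₂ g :=
    Computable.option_casesOn_bool (o := fun x : α × ℕ => Encodable.decode (α := β) x.2)
      (d := fun x : (α × ℕ) × β => d (x.1.1, x.2)) false (Computable.decode.comp Computable.snd)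
      (hd.comp ((Computable.fst.comp Computable.fst).pair Computable.snd))
  refine (Partrec.rfind (p := fun a n => Part.some (g a n)) hg.partrec₂).dom_re.of_eq fun a => ?_
  refine Nat.rfind_dom'.trans ⟨?_, ?_⟩
  · rintro ⟨n, hn, -⟩
    have hn : g a n = true := (Part.mem_some_iff.1 hn).symm
    simp only [g] at hn
    cases hb : Encodable.decode (α := β) n with
    | none => simp [hb] at hn
    | some b => exact ⟨b, (hdP a b).1 (by simpa [hb] using hn)⟩
  · rintro ⟨b, hb⟩
    exact ⟨Encodable.encode b, by simp [g, (hdP a b).2 hb], fun _ => trivial⟩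

end ComputablePred

/-! ### Computable operations on words -/

section Words

variable {m : ℕ}

/-- All words of length at most `n`. -/
noncomputable def wordsUpTo (m : ℕ) (n : ℕ) : List (GWord m) :=
  Nat.rec [[]] (fun _ l => [] :: l.flatMap fun w => Finset.univ.toList.map fun a => a :: w) n

theorem mem_wordsUpTo {n : ℕ} {W : GWord m} : W ∈ wordsUpTo m n ↔ W.length ≤ n := by
  induction n generalizing W with
  | zero => simp [wordsUpTo]
  | succ n ih =>
    have : wordsUpTo m (n + 1) =
      [] :: (wordsUpTo m n).flatMap fun w => Finset.univ.toList.map fun a => a :: w := rfl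
    rw [this]
    cases W with
    | nil => simp
    | cons a W => simp [ih]

/-- The list of letters comes from a choice of order on a fixed finite type, so it is a constant and
does not affect computability. -/
theorem computable_wordsUpTo : Computable (wordsUpTo m) := by
  have h1 : Primrec₂ fun (x : ℕ × ℕ × List (GWord m)) (w : GWord m) =>
      Finset.univ.toList.map fun a : Fin m × Bool => a :: w :=
    Primrec.list_map (Primrec.const _)
      (Primrec.list_cons.comp Primrec.snd (Primrec.snd.comp Primrec.fst))
  have h2 : Primrec fun x : ℕ × ℕ × List (GWord m) => ([] : GWord m) ::
      x.2.2.flatMap fun w => Finset.univ.toList.map fun a : Fin m × Bool => a :: w :=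
    Primrec.list_cons.comp (Primrec.const []) (Primrec.list_flatMap
      (Primrec.snd.comp Primrec.snd) h1)
  exact (Computable.nat_rec (f := fun n : ℕ => n) (g := fun _ => ([[]] : List (GWord m)))
    (h := fun _ x => [] :: x.2.flatMap fun w => Finset.univ.toList.map fun a => a :: w)
    Computable.id (Computable.const _) h2.to_comp).of_eq fun _ => rfl

theorem primrec_letterInv : Primrec (letterInv : Fin m × Bool → Fin m × Bool) :=
  Primrec.fst.pair (Primrec.not.comp Primrec.snd)

theorem computable_invRev : Computable (FreeGroup.invRev : GWord m → GWord m) :=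
  (Primrec.list_reverse.comp (Primrec.list_map Primrec.id
    (primrec_letterInv.comp Primrec.snd).to₂)).to_comp

theorem isRotated_iff_exists_drop_append_take {α : Type*} {l l' : List α} :
    l ~r l' ↔ ∃ n ∈ List.range (l.length + 1), l' = l.drop n ++ l.take n := by
  constructor
  · intro h
    obtain ⟨n, hn, rfl⟩ := List.isRotated_iff_mod.1 h
    exact ⟨n, List.mem_range.2 (by omega), List.rotate_eq_drop_append_take hn⟩
  · rintro ⟨n, -, rfl⟩
    exact List.isRotated_of_eq_append (l.take n) (l.drop n) (by simp) rfl

variable {α : Type*} [Primcodable α]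

theorem Computable.list_take' {β : Type*} [Primcodable β] {f : α → ℕ} {g : α → List β}
    (hf : Computable f) (hg : Computable g) : Computable fun a => (g a).take (f a) :=
  Primrec.list_take.to_comp.comp hf hg

theorem Computable.list_drop' {β : Type*} [Primcodable β] {f : α → ℕ} {g : α → List β}
    (hf : Computable f) (hg : Computable g) : Computable fun a => (g a).drop (f a) :=
  Primrec.list_drop.to_comp.comp hf hg

theorem Computable.range_length_succ {β : Type*} [Primcodable β] {g : α → List β}
    (hg : Computable g) : Computable fun a => List.range ((g a).length + 1) :=
  Primrec.list_range.to_comp.comp (Computable.succ.comp (Computable.list_length.comp hg))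

theorem ComputablePred.isRotated {β : Type*} [Primcodable β] {f g : α → List β}
    (hf : Computable f) (hg : Computable g) : ComputablePred fun a => f a ~r g a := by
  refine (ComputablePred.exists_mem (Computable.range_length_succ hf) ?_).of_eq
    fun a => isRotated_iff_exists_drop_append_take.symm
  exact ComputablePred.eq (hg.comp Computable.fst) (Computable.list_append.comp
    (Computable.list_drop' Computable.snd (hf.comp Computable.fst))
    (Computable.list_take' Computable.snd (hf.comp Computable.fst)))

/-- It suffices to test the finitely many rotations of `w` and their inverses, even if `R` is
infinite. -/
theorem computablePred_symmetrized {R : Set (GWord m)} (hR : DecidableRelators R) :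
    ComputablePred fun w : GWord m => w ∈ symmetrized R := by
  have h : ComputablePred fun w : GWord m => ∃ n ∈ List.range (w.length + 1),
      w.drop n ++ w.take n ∈ R ∨ FreeGroup.invRev (w.drop n ++ w.take n) ∈ R := by
    have hc : Computable fun x : GWord m × ℕ => x.1.drop x.2 ++ x.1.take x.2 :=
      Computable.list_append.comp (Computable.list_drop' Computable.snd Computable.fst)
        (Computable.list_take' Computable.snd Computable.fst)
    exact ComputablePred.exists_mem (Computable.range_length_succ Computable.id)
      ((ComputablePred.comp hR hc).or (ComputablePred.comp hR (computable_invRev.comp hc)))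
  refine h.of_eq fun w => ?_
  constructor
  · rintro ⟨n, hn, h | h⟩
    · exact ⟨_, h, Or.inl (isRotated_iff_exists_drop_append_take.2 ⟨n, hn, rfl⟩)⟩
    · exact ⟨_, h, Or.inr (by
        rw [FreeGroup.invRev_invRev]
        exact isRotated_iff_exists_drop_append_take.2 ⟨n, hn, rfl⟩)⟩
  · rintro ⟨r, hr, h | h⟩
    · obtain ⟨n, hn, rfl⟩ := isRotated_iff_exists_drop_append_take.1 h
      exact ⟨n, hn, Or.inl hr⟩
    · obtain ⟨n, hn, h⟩ := isRotated_iff_exists_drop_append_take.1 h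
      exact ⟨n, hn, Or.inr (by rwa [← h, FreeGroup.invRev_invRev])⟩

end Words

/-! ### Decidability of the diagram calculus -/

/-- `y` is obtained by one of the rules of `HasDiagram` from members of the list `S`. -/
def DiagramStep {m : ℕ} (R : Set (GWord m)) (p q : ℕ) (S : List (GWord m × ℕ))
    (y : GWord m × ℕ) : Prop :=
  y = ([], p) ∨ (∃ z ∈ S, z.1 ~r y.1 ∧ z.2 = y.2) ∨
    (∃ z ∈ S, ∃ z' ∈ S, ∃ a ∈ (Finset.univ : Finset (Fin m × Bool)).toList,
      y = (a :: (z.1 ++ letterInv a :: z'.1), z.2 + z'.2 + q)) ∨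
    ∃ z ∈ S, ∃ n ∈ List.range (z.1.length + 1),
      ∃ a ∈ (Finset.univ : Finset (Fin m × Bool)).toList,
      letterInv a :: z.1.take n ∈ symmetrized R ∧ y = (a :: z.1.drop n, z.2 + q)

namespace DiagramStep

variable {m : ℕ} {R : Set (GWord m)} {p q : ℕ}

/-- All witnesses range over finite lists: members of `S`, letters, and positions at which to split
a word. -/
theorem computablePred (hR : DecidableRelators R) :
    ComputablePred fun x : List (GWord m × ℕ) × (GWord m × ℕ) => DiagramStep R p q x.1 x.2 := by
  open Computable in
  have fs : ∀ {α β γ : Type} [Primcodable α] [Primcodable β] [Primcodable γ] {f : α → β × γ},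
      Computable f → (Computable fun a => (f a).1) ∧ Computable fun a => (f a).2 :=
    fun hf => ⟨fst.comp hf, snd.comp hf⟩
  have hadd : ∀ {α : Type} [Primcodable α] {f g : α → ℕ}, Computable f → Computable g →
      Computable fun a => f a + g a := fun hf hg => Primrec.nat_add.to_comp.comp hf hg
  refine .or (.eq Computable.snd (.const _)) (.or ?_ (.or ?_ ?_))
  · refine .exists_mem Computable.fst ?_
    have h1 := fs (Computable.id (α := (List (GWord m × ℕ) × (GWord m × ℕ)) × (GWord m × ℕ)))
    have hy := fs (fs h1.1).2
    have hz := fs h1.2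
    exact .and (.isRotated hz.1 hy.1) (.eq hz.2 hy.2)
  · refine .exists_mem Computable.fst (.exists_mem (Computable.fst.comp Computable.fst)
      (.exists_mem (.const _) ?_))
    have h1 := fs (Computable.id (α := (((List (GWord m × ℕ) × (GWord m × ℕ)) × (GWord m × ℕ)) ×
      (GWord m × ℕ)) × (Fin m × Bool)))
    have h2 := fs h1.1
    have h3 := fs h2.1
    have hz := fs h3.2
    have hz' := fs h2.2
    refine .eq (fs h3.1).2 (.pair ?_ (hadd (hadd hz.2 hz'.2) (.const q)))
    exact Computable.list_cons.comp h1.2 (Computable.list_append.comp hz.1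
      (Computable.list_cons.comp (primrec_letterInv.to_comp.comp h1.2) hz'.1))
  · refine .exists_mem Computable.fst (.exists_mem (Computable.range_length_succ
      (Computable.fst.comp Computable.snd)) (.exists_mem (.const _) ?_))
    have h1 := fs (Computable.id (α := (((List (GWord m × ℕ) × (GWord m × ℕ)) × (GWord m × ℕ)) ×
      ℕ) × (Fin m × Bool)))
    have h2 := fs h1.1
    have h3 := fs h2.1
    have hz := fs h3.2
    refine .and (.comp (computablePred_symmetrized hR) (Computable.list_cons.comp
      (primrec_letterInv.to_comp.comp h1.2) (Computable.list_take' h2.2 hz.1))) ?_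
    exact .eq (fs h3.1).2 (.pair (Computable.list_cons.comp h1.2
      (Computable.list_drop' h2.2 hz.1)) (hadd hz.2 (.const q)))

theorem mono {S T : List (GWord m × ℕ)} (hST : S ⊆ T) {y : GWord m × ℕ}
    (h : DiagramStep R p q S y) : DiagramStep R p q T y := by
  rcases h with h | ⟨z, hz, h⟩ | ⟨z, hz, z', hz', h⟩ | ⟨z, hz, h⟩
  · exact .inl h
  · exact .inr (.inl ⟨z, hST hz, h⟩)
  · exact .inr (.inr (.inl ⟨z, hST hz, z', hST hz', h⟩))
  · exact .inr (.inr (.inr ⟨z, hST hz, h⟩))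

theorem hasDiagram {S : List (GWord m × ℕ)} (hS : ∀ z ∈ S, HasDiagram R p q z.1 z.2)
    {y : GWord m × ℕ} (h : DiagramStep R p q S y) : HasDiagram R p q y.1 y.2 := by
  rcases h with rfl | ⟨z, hz, hr, h⟩ | ⟨z, hz, z', hz', a, -, rfl⟩ | ⟨z, hz, n, -, a, -, h, rfl⟩
  · exact .point
  · exact h ▸ (hS z hz).rotate hr
  · exact .bridge a (hS z hz) (hS z' hz')
  · exact .face a (by simpa using hS z hz) h

theorem of_rotate {S : List (GWord m × ℕ)} {W W' : GWord m} {c : ℕ} (h : (W, c) ∈ S)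
    (hr : W ~r W') : DiagramStep R p q S (W', c) :=
  .inr (.inl ⟨_, h, hr, rfl⟩)

theorem of_bridge {S : List (GWord m × ℕ)} {u v : GWord m} {c₁ c₂ : ℕ} (a : Fin m × Bool)
    (hu : (u, c₁) ∈ S) (hv : (v, c₂) ∈ S) :
    DiagramStep R p q S (a :: (u ++ letterInv a :: v), c₁ + c₂ + q) :=
  .inr (.inr (.inl ⟨_, hu, _, hv, a, by simp, rfl⟩))

theorem of_face {S : List (GWord m × ℕ)} {s w : GWord m} {c : ℕ} (a : Fin m × Bool)
    (h : (s ++ w, c) ∈ S) (hs : letterInv a :: s ∈ symmetrized R) :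
    DiagramStep R p q S (a :: w, c + q) :=
  .inr (.inr (.inr ⟨_, h, s.length, by simp, a, by simp, by simpa using hs, by simp⟩))

end DiagramStep

namespace HasDiagram

variable {m : ℕ} {R : Set (GWord m)} {p q : ℕ}

/-- Every entry of the list `S` follows from later entries by a rule of `HasDiagram`. -/
def IsDerivation (R : Set (GWord m)) (p q : ℕ) (S : List (GWord m × ℕ)) : Prop :=
  ∀ n ∈ List.range (S.length + 1), ∀ y ∈ (S.drop n).take 1, DiagramStep R p q (S.drop (n + 1)) y

theorem isDerivation_nil : IsDerivation R p q [] := by simp [IsDerivation]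

theorem isDerivation_cons {S : List (GWord m × ℕ)} {y : GWord m × ℕ} :
    IsDerivation R p q (y :: S) ↔ DiagramStep R p q S y ∧ IsDerivation R p q S := by
  constructor
  · intro h
    refine ⟨by simpa using h 0 (by simp) y (by simp), fun n hn z hz => ?_⟩
    simpa using h (n + 1) (by simp at hn ⊢; omega) z (by simpa using hz)
  · rintro ⟨h, h'⟩ n hn z hz
    cases n with
    | zero =>
      simp only [List.drop_zero, List.take_succ_cons, List.take_zero, List.mem_singleton] at hz
      simpa [hz] using h
    | succ n => simpa using h' n (by simp at hn ⊢; omega) z (by simpa using hz)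

theorem IsDerivation.append {S T : List (GWord m × ℕ)} (hS : IsDerivation R p q S)
    (hT : IsDerivation R p q T) : IsDerivation R p q (S ++ T) := by
  induction S with
  | nil => exact hT
  | cons y S ih =>
    rw [isDerivation_cons] at hS
    exact isDerivation_cons.2 ⟨hS.1.mono (List.subset_append_left S T), ih hS.2⟩

theorem IsDerivation.hasDiagram {S : List (GWord m × ℕ)} (hS : IsDerivation R p q S) :
    ∀ z ∈ S, HasDiagram R p q z.1 z.2 := by
  induction S with
  | nil => simp
  | cons y S ih =>
    rw [isDerivation_cons] at hS
    exact List.forall_mem_cons.2 ⟨hS.1.hasDiagram (ih hS.2), ih hS.2⟩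

theorem exists_isDerivation {W : GWord m} {c : ℕ} (h : HasDiagram R p q W c) :
    ∃ S, IsDerivation R p q S ∧ (W, c) ∈ S := by
  induction h with
  | point => exact ⟨[([], p)], isDerivation_cons.2 ⟨.inl rfl, isDerivation_nil⟩, by simp⟩
  | rotate h hr ih =>
    obtain ⟨S, hS, hmem⟩ := ih
    exact ⟨_ :: S, isDerivation_cons.2 ⟨.of_rotate hmem hr, hS⟩, List.mem_cons_self⟩
  | bridge a hu hv ihu ihv =>
    obtain ⟨S, hS, hmem⟩ := ihu
    obtain ⟨T, hT, hmem'⟩ := ihv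
    exact ⟨_ :: (S ++ T), isDerivation_cons.2 ⟨.of_bridge a (List.mem_append_left T hmem)
      (List.mem_append_right S hmem'), hS.append hT⟩, List.mem_cons_self⟩
  | face a h hs ih =>
    obtain ⟨S, hS, hmem⟩ := ih
    exact ⟨_ :: S, isDerivation_cons.2 ⟨.of_face a hmem hs, hS⟩, List.mem_cons_self⟩

/-- The list `S` is closed under the rules of `HasDiagram`, as far as pairs of cost at most `c` are
concerned. -/
def IsClosedList (R : Set (GWord m)) (p q c : ℕ) (S : List (GWord m × ℕ)) : Prop :=
  ∀ W ∈ wordsUpTo m (3 * c), ∀ k ∈ List.range (c + 1), DiagramStep R p q S (W, k) → (W, k) ∈ S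

/-- No rule lowers the cost, so every premise in the construction of a diagram of cost at most `c`
also has cost at most `c`, and by `length_le` its word has length at most 3c. Closure within these
bounds thus captures the whole construction. -/
theorem mem_of_isClosedList (hlen : ∀ r ∈ R, 1 < r.length) (hpq : 1 ≤ p + q) {c : ℕ}
    {S : List (GWord m × ℕ)} (hS : IsClosedList R p q c S) {W : GWord m} {k : ℕ}
    (h : HasDiagram R p q W k) (hk : k ≤ c) : (W, k) ∈ S := by
  have key : ∀ {W : GWord m} {k : ℕ}, HasDiagram R p q W k → k ≤ c →
      DiagramStep R p q S (W, k) → (W, k) ∈ S := fun h hk hs => by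
    have := h.length_le hlen hpq
    exact hS _ (mem_wordsUpTo.2 (by omega)) _ (List.mem_range.2 (by omega)) hs
  induction h with
  | point => exact key .point hk (.inl rfl)
  | rotate h hr ih => exact key (h.rotate hr) hk (.of_rotate (ih hk) hr)
  | bridge a hu hv ihu ihv =>
    exact key (.bridge a hu hv) hk (.of_bridge a (ihu (by omega)) (ihv (by omega)))
  | face a h hs ih => exact key (.face a h hs) hk (.of_face a (ih (by omega)) hs)

/-- The finite list of all valid pairs within the bounds is closed; it need not be computed, only to
exist. -/
theorem exists_isClosedList (R : Set (GWord m)) (p q c : ℕ) :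
    ∃ S, IsClosedList R p q c S ∧ ∀ z ∈ S, HasDiagram R p q z.1 z.2 := by
  classical
  refine ⟨(wordsUpTo m (3 * c) ×ˢ List.range (c + 1)).filter
    fun z => decide (HasDiagram R p q z.1 z.2), fun W hW k hk h => ?_, fun z hz => by
      simpa using (List.mem_filter.1 hz).2⟩
  refine List.mem_filter.2 ⟨List.mem_product.2 ⟨hW, hk⟩, decide_eq_true ?_⟩
  exact h.hasDiagram fun z hz => by simpa using (List.mem_filter.1 hz).2

theorem computablePred (hR : DecidableRelators R) (hlen : ∀ r ∈ R, 1 < r.length)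
    (hpq : 1 ≤ p + q) : ComputablePred fun x : GWord m × ℕ => HasDiagram R p q x.1 x.2 := by
  -- By Post's theorem, validity is certified by a derivation and invalidity by a closed list that
  -- omits the pair. A direct recursion on the cost would not do, since the face rule costs nothing
  -- when `q = 0`.
  refine ComputablePred.computable_iff_re_compl_re'.2 ⟨?_, ?_⟩
  · have hder : ComputablePred (IsDerivation R p q) := by
      have hdrop : Computable fun x : List (GWord m × ℕ) × ℕ => x.1.drop x.2 :=
        Computable.list_drop' Computable.snd Computable.fst
      refine .forall_mem (Computable.range_length_succ Computable.id) (.forall_mem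
        (Computable.list_take' (.const 1) hdrop) ?_)
      exact .comp (DiagramStep.computablePred hR) (.pair (Computable.list_drop'
        (Computable.succ.comp (Computable.snd.comp Computable.fst))
        (Computable.fst.comp Computable.fst)) Computable.snd)
    refine (ComputablePred.exists_re (β := List (GWord m × ℕ))
      (P := fun x S => IsDerivation R p q S ∧ x ∈ S)
      (.and (.comp hder Computable.snd) (.mem Computable.snd Computable.fst))).of_eq fun x => ?_
    exact ⟨fun ⟨S, hS, hx⟩ => hS.hasDiagram x hx, fun h => h.exists_isDerivation⟩
  · have hclosed : ComputablePred fun x : ℕ × List (GWord m × ℕ) =>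
        IsClosedList R p q x.1 x.2 := by
      refine .forall_mem (computable_wordsUpTo.comp ((Primrec.nat_mul.comp (.const 3)
        Primrec.fst).to_comp)) (.forall_mem (Primrec.list_range.comp (Primrec.succ.comp
        (Primrec.fst.comp Primrec.fst))).to_comp ?_)
      have hy : Computable fun x : ((ℕ × List (GWord m × ℕ)) × GWord m) × ℕ => (x.1.2, x.2) :=
        .pair (Computable.snd.comp Computable.fst) Computable.snd
      have hS : Computable fun x : ((ℕ × List (GWord m × ℕ)) × GWord m) × ℕ => x.1.1.2 :=
        Computable.snd.comp (Computable.fst.comp Computable.fst)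
      exact .imp (.comp (DiagramStep.computablePred hR) (hS.pair hy)) (.mem hS hy)
    refine (ComputablePred.exists_re (β := List (GWord m × ℕ))
      (P := fun x S => IsClosedList R p q x.2 S ∧ x ∉ S)
      (.and (.comp hclosed (.pair (Computable.snd.comp Computable.fst) Computable.snd))
        (ComputablePred.mem Computable.snd Computable.fst).not)).of_eq fun x => ?_
    constructor
    · rintro ⟨S, hS, hx⟩ h
      exact hx (mem_of_isClosedList hlen hpq hS h le_rfl)
    · intro h
      obtain ⟨S, hS, hS'⟩ := exists_isClosedList R p q x.2
      exact ⟨S, hS, fun hx => h (hS' x hx)⟩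

end HasDiagram

/-! ### Minimal diagrams and Dehn functions -/

theorem InNormalClosure.exists_hasDiagram {m : ℕ} {R : Set (GWord m)}
    (hlen : ∀ r ∈ R, 1 < r.length) {W : GWord m} (h : InNormalClosure R W) (p q : ℕ) :
    ∃ c, HasDiagram R p q W c := by
  -- Van Kampen's lemma needs `q > 0` for its induction on the cost. Passing through an actual
  -- complex allows the same diagram to be measured with arbitrary `p` and `q`.
  obtain ⟨_, hc⟩ := HasDiagram.exists_of_inNormalClosure (p := 0) one_pos hlen h
  obtain ⟨Δ, hΔ, hW, -⟩ := hc.exists_complex hlen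
  exact ⟨_, Δ.hasDiagram hΔ hW p q⟩

section DehnFunction

variable {m : ℕ} {R : Set (GWord m)} {p q : ℕ} {j : Fin 3}

theorem minCells_eq_sInf (hlen : ∀ r ∈ R, 1 < r.length)
    (hj : ∀ Δ : PlaneComplex, Δ.numCells j = p * Nat.card Δ.V + q * Nat.card Δ.E) (W : GWord m) :
    minCells R j W = sInf {n | HasDiagram R p q W n} := by
  unfold minCells
  congr 1
  ext n
  constructor
  · rintro ⟨Δ, hΔ, hW, rfl⟩
    rw [hj]
    exact Δ.hasDiagram hΔ hW p q
  · intro h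
    obtain ⟨Δ, hΔ, hW, hn⟩ := HasDiagram.exists_complex hlen h
    exact ⟨Δ, hΔ, hW, (hj _).trans hn⟩

theorem hasDiagram_minCells (hlen : ∀ r ∈ R, 1 < r.length)
    (hj : ∀ Δ : PlaneComplex, Δ.numCells j = p * Nat.card Δ.V + q * Nat.card Δ.E) {W : GWord m}
    (h : InNormalClosure R W) : HasDiagram R p q W (minCells R j W) := by
  rw [minCells_eq_sInf hlen hj]
  -- The infimum of the empty set would be 0, so attaining it requires the existence of a diagram.
  exact Nat.sInf_mem (h.exists_hasDiagram hlen p q)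

theorem minCells_le (hlen : ∀ r ∈ R, 1 < r.length)
    (hj : ∀ Δ : PlaneComplex, Δ.numCells j = p * Nat.card Δ.V + q * Nat.card Δ.E) {W : GWord m}
    {n : ℕ} (h : HasDiagram R p q W n) : minCells R j W ≤ n := by
  rw [minCells_eq_sInf hlen hj]
  exact Nat.sInf_le h

/-- Finitely many words have length at most `x` and the empty word is trivial, so the supremum is
that of a bounded nonempty set and not a default value. -/
theorem dehnFunction_le_iff (R : Set (GWord m)) (j : Fin 3) (x y : ℕ) :
    dehnFunction R j x ≤ y ↔
      ∀ W : GWord m, W.length ≤ x → InNormalClosure R W → minCells R j W ≤ y := by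
  have hfin : {n | ∃ W : GWord m, InNormalClosure R W ∧ W.length ≤ x ∧
      minCells R j W = n}.Finite := by
    refine ((List.finite_toSet (wordsUpTo m x)).image (minCells R j)).subset ?_
    rintro _ ⟨W, -, hW, rfl⟩
    exact ⟨W, mem_wordsUpTo.2 hW, rfl⟩
  have hne : {n | ∃ W : GWord m, InNormalClosure R W ∧ W.length ≤ x ∧
      minCells R j W = n}.Nonempty :=
    ⟨_, [], Subgroup.one_mem _, Nat.zero_le _, rfl⟩
  unfold dehnFunction
  rw [csSup_le_iff hfin.bddAbove hne]
  exact ⟨fun h W hW hN => h _ ⟨W, hN, hW, rfl⟩, by rintro h _ ⟨W, hN, hW, rfl⟩; exact h W hW hN⟩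

theorem computablePred_exists_hasDiagram (hR : DecidableRelators R)
    (hlen : ∀ r ∈ R, 1 < r.length) (hpq : 1 ≤ p + q) :
    ComputablePred fun x : GWord m × ℕ => ∃ n ∈ List.range (x.2 + 1), HasDiagram R p q x.1 n :=
  .exists_mem ((Primrec.list_range.comp (Primrec.succ.comp Primrec.snd)).to_comp)
    (.comp (HasDiagram.computablePred hR hlen hpq)
      (.pair (Computable.fst.comp Computable.fst) Computable.snd))

theorem minCells_le_iff (hlen : ∀ r ∈ R, 1 < r.length)
    (hj : ∀ Δ : PlaneComplex, Δ.numCells j = p * Nat.card Δ.V + q * Nat.card Δ.E) {W : GWord m}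
    (h : InNormalClosure R W) (y : ℕ) :
    minCells R j W ≤ y ↔ ∃ n ∈ List.range (y + 1), HasDiagram R p q W n := by
  constructor
  · exact fun hy => ⟨_, List.mem_range.2 (by omega), hasDiagram_minCells hlen hj h⟩
  · rintro ⟨n, hn, hW⟩
    have := minCells_le hlen hj hW
    rw [List.mem_range] at hn
    omega

theorem wordProblemSolvable_iff_computable_dehnFunction (hR : DecidableRelators R)
    (hlen : ∀ r ∈ R, 1 < r.length) (hpq : 1 ≤ p + q)
    (hj : ∀ Δ : PlaneComplex, Δ.numCells j = p * Nat.card Δ.V + q * Nat.card Δ.E) :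
    WordProblemSolvable R ↔ Computable (dehnFunction R j) := by
  classical
  constructor
  · intro hN
    -- The Dehn function at `x` is the least `y` with `P x y`. A solvable word problem makes `P`
    -- decidable, so the search for `y` is computable.
    let P : ℕ → ℕ → Prop := fun x y => ∀ W ∈ wordsUpTo m x, InNormalClosure R W →
      ∃ n ∈ List.range (y + 1), HasDiagram R p q W n
    have hP : ∀ x y, P x y ↔ dehnFunction R j x ≤ y := fun x y => by
      simp only [P, dehnFunction_le_iff, mem_wordsUpTo]
      exact forall₃_congr fun W _ hW => (minCells_le_iff hlen hj hW y).symm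
    have hex : ∀ x, ∃ y, P x y := fun x => ⟨_, (hP x _).2 le_rfl⟩
    refine (Computable.find (P := P) ?_ hex).of_eq fun x => ?_
    · refine .forall_mem (computable_wordsUpTo.comp Computable.fst) (.imp (.comp hN Computable.snd)
        (.comp (computablePred_exists_hasDiagram hR hlen hpq)
          (.pair Computable.snd (Computable.snd.comp Computable.fst))))
    · rw [Nat.find_eq_iff]
      exact ⟨(hP x _).2 le_rfl, fun y hy h => (hP x y).1 h |>.not_gt hy⟩
  · intro hf
    -- Membership of `W` is decided by looking for a diagram of cost at most the Dehn function at
    -- |W|.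
    refine (ComputablePred.comp (computablePred_exists_hasDiagram hR hlen hpq)
      (.pair Computable.id (hf.comp Computable.list_length))).of_eq fun W => ?_
    constructor
    · rintro ⟨n, -, h⟩
      exact h.inNormalClosure
    · intro h
      exact (minCells_le_iff hlen hj h _).1 ((dehnFunction_le_iff R j _ _).1 le_rfl W le_rfl h)

end DehnFunction

theorem theorem1p5 (m : ℕ) (R : Set (GWord m))
    (hcyc : ∀ r ∈ R, FreeGroup.IsCyclicallyReduced r)
    (hlen : ∀ r ∈ R, 1 < r.length)
    (hdec : DecidableRelators R) :
    (WordProblemSolvable R ↔ Computable (dehnFunction R 0)) ∧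
      (Computable (dehnFunction R 0) ↔ Computable (dehnFunction R 1)) := by
  have h₀ : WordProblemSolvable R ↔ Computable (dehnFunction R 0) :=
    wordProblemSolvable_iff_computable_dehnFunction (p := 1) (q := 0) hdec hlen le_rfl
      fun Δ => by simp [PlaneComplex.numCells]
  have h₁ : WordProblemSolvable R ↔ Computable (dehnFunction R 1) :=
    wordProblemSolvable_iff_computable_dehnFunction (p := 0) (q := 1) hdec hlen le_rfl
      fun Δ => by simp [PlaneComplex.numCells]
  exact ⟨h₀, h₀.symm.trans h₁⟩
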